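/- **Setting.** Let $A\in\mathbb R^{n\times n}$ be symmetric with zero diagonal and $\theta\in\mathbb R^n$. The Ising model $\mathcal D(A,\theta)$ is the distribution on $\{-1,1\}^n$ with $\Pr[Z=z]\propto\exp\big(\sum_{i<j}A_{ij}z_iz_j+\sum_i\theta_iz_i\big)$. Let $\lambda\ge\max_i\big(\sum_j|A_{ij}|+|\theta_i|\big)$. For known $p_1,\dots,p_n\in[0,1)$, a sample $X\sim\mathcal D_{\mathsf{miss}}$ with missing data is obtained by drawing $Z\sim\mathcal D(A,\theta)$ and, independently for each $i$, putting $X_i=0$ (missing) with probability $p_i$ and $X_i=Z_i$ otherwise. Let $p_{\max}<1$ be a bound with $p_i\le p_{\max}$ for all $i$. Fix a vertex, without loss of generality the vertex $n$ (the same statement holds for every vertex). For $v\in\mathbb R^n$ let $S(v)=\mathbb E_{Z\sim\mathcal D(A,\theta)}\big[\exp\big(-\sum_{j=1}^{n-1}v_jZ_nZ_j-v_nZ_n\big)\big]$ be the modified interaction screening objective, and let $v^*=(A_{n1},\dots,A_{n,n-1},\theta_n)$. Let $\Delta(\lambda,2n+1)=\{w\in\mathbb R^{2n+1}:w\ge0,\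 \sum_kw_k=\lambda\}$, and for $w\in\mathbb R^{2n+1}$ let $\Pi(w)=(w_i-w_{n+i})_{i=1}^n$ and $\widetilde S(w)=S(\Pi(w))$. With $v=\Pi(w)$ put, for $i\le n-1$, $$g^i(w;X)=-\frac{e^{-v_nX_n}X_n}{1-p_n}\cdot\frac{e^{-v_iX_nX_i}X_i}{1-p_i}\prod_{j\ne i,n}\frac{e^{-v_jX_nX_j}-p_j}{1-p_j},\qquad g^n(w;X)=-\frac{e^{-v_nX_n}X_n}{1-p_n}\prod_{j\ne n}\frac{e^{-v_jX_nX_j}-p_j}{1-p_j},$$ and $G(w;X)=\sum_{i=1}^ng^i(w;X)(e^i-e^{n+i})\in\mathbb R^{2n+1}$. The algorithm with step size $\eta$ starts from $w^1_k=\lambda/(2n+1)$ for all $k$. For $t=1,\dots,T$ it takes a fresh independent sample $X^t\sim\mathcal D_{\mathsf{miss}}$ and sets $w^{t+1}_k=w^t_k\big(1-\eta\,G(w^t;X^t)_k+\eta\,C^t\big)$ with $C^t=\langle w^t,G(w^t;X^t)\rangle/\lambda$. It returns $\bar w=\frac1T\sum_{t=1}^Tw^t$. **Theorem.** 1. (Restricted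 strong convexity.) For all $v\in\mathbb R^n$ with $\|v\|_1\le\lambda$, $$S(v)-S(v^*)\ \ge\ \nabla S(v^*)^{T}(v-v^*)+\frac{e^{-3\lambda}}{2(1+\lambda)}\max_{i\le n-1}|v_i-A_{ni}|^2 .$$ 2. (Unbiased bounded estimator.) $\mathbb E_{X\sim\mathcal D_{\mathsf{miss}}}[G(w;X)]=\nabla\widetilde S(w)$ for every $w\in\mathbb R^{2n+1}$, and $\|G(w;X)\|_\infty\le\frac1{(1-p_{\max})^2}\exp\big(\frac{\lambda}{1-p_{\max}}\big)$ for all $w\in\Delta(\lambda,2n+1)$ and $X\in\{-1,0,1\}^n$. 3. (Recovery.) For every $p_{\max}<1$ and $\lambda_0>0$ there is a constant $C>0$, depending only on $p_{\max}$ and $\lambda_0$, such that the following holds for all $n$, all $p_1,\dots,p_n\in[0,p_{\max}]$, all $\lambda\ge\lambda_0$ and all $T$. There is a step size $\eta>0$, which does not depend on the unknown model $(A,\theta)$, nor on $\epsilon$ and $\delta$, such that for every Ising model $\mathcal D(A,\theta)$ of width at most $\lambda$, every $\epsilon>0$ and every $\delta\in(0,1)$ with $$T\ \ge\ \lambda^4\log(n/\delta)\,\exp(C\lambda)\,\epsilon^{-4},$$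 with probability at least $1-\delta$ the output of the algorithm satisfies $|\Pi(\bar w)_i-A_{ni}|\le\epsilon$ for all $i\in[n-1]$. -/

import Mathlib

open MeasureTheory ProbabilityTheory

namespace MissingIsing

noncomputable section

instance : DiscreteMeasurableSpace ℤˣ where
  forall_measurableSet s := by
    refine ⟨(fun z : ℤˣ => (z : ℤ)) '' s, MeasurableSet.of_discrete, ?_⟩
    exact Set.preimage_image_eq s Units.val_injective

/-- The exponent of the Ising model `D(A, θ)` at the spin configuration `z ∈ {-1, 1}ⁿ`; each
unordered pair `{i, j}` is counted once (pairs that are not edges have `A i j = 0`). -/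
def energy {n : ℕ} (A : Matrix (Fin n) (Fin n) ℝ) (θ : Fin n → ℝ) (z : Fin n → ℤˣ) : ℝ :=
  ∑ i, ∑ j ∈ Finset.Ioi i, A i j * ((z i : ℤ) : ℝ) * ((z j : ℤ) : ℝ) + ∑ i, θ i * ((z i : ℤ) : ℝ)

/-- The Ising model `D(A, θ)`: the probability of `z` is proportional to `exp (energy A θ z)`. -/
def isingPMF {n : ℕ} (A : Matrix (Fin n) (Fin n) ℝ) (θ : Fin n → ℝ) : PMF (Fin n → ℤˣ) :=
  PMF.normalize (fun z => ENNReal.ofReal (Real.exp (energy A θ z)))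
    (by
      rw [tsum_fintype]
      intro h
      have h1 := (Finset.sum_eq_zero_iff.mp h) (fun _ => 1) (Finset.mem_univ _)
      exact absurd (ENNReal.ofReal_eq_zero.mp h1) (not_le.mpr (Real.exp_pos _)))
    (by
      rw [tsum_fintype]
      exact ENNReal.sum_ne_top.mpr fun _ _ => ENNReal.ofReal_ne_top)

/-- The Ising model as a probability measure on `{-1, 1}ⁿ`. -/
def isingLaw {n : ℕ} (A : Matrix (Fin n) (Fin n) ℝ) (θ : Fin n → ℝ) : Measure (Fin n → ℤˣ) :=
  (isingPMF A θ).toMeasure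

instance {n : ℕ} (A : Matrix (Fin n) (Fin n) ℝ) (θ : Fin n → ℝ) :
    IsProbabilityMeasure (isingLaw A θ) := by
  unfold isingLaw; infer_instance

/-- The width `max_i (∑_j |A i j| + |θ i|)`. -/
def width {n : ℕ} (A : Matrix (Fin n) (Fin n) ℝ) (θ : Fin n → ℝ) : ℝ :=
  ⨆ i, (∑ j, |A i j| + |θ i|)

/-- Erase the entries of `z` whose mask bit is `false`; the symbol `?` is written as `0`. -/
def applyMask {n : ℕ} (zc : (Fin n → ℤˣ) × (Fin n → Bool)) : Fin n → ℤ :=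
  fun i => if zc.2 i then (zc.1 i : ℤ) else 0

/-- The law of one sample with missing data: draw `z` from the Ising model and, independently of `z`
and of the other entries, erase the `i`-th entry with probability `p i`. -/
def missLaw {n : ℕ} (A : Matrix (Fin n) (Fin n) ℝ) (θ : Fin n → ℝ) (p : Fin n → unitInterval) :
    Measure (Fin n → ℤ) :=
  ((isingLaw A θ).prod (Measure.pi fun i => bernoulliMeasure false true (p i))).map applyMask

instance {n : ℕ} (A : Matrix (Fin n) (Fin n) ℝ) (θ : Fin n → ℝ) (p : Fin n → unitInterval) :
    IsProbabilityMeasure (missLaw A θ p) :=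
  Measure.isProbabilityMeasure_map (Measurable.of_discrete.aemeasurable)

/-- The modified interaction screening objective at the vertex `r`. The vector `v` is indexed by the
vertices; its coordinate at `r` itself is the one that belongs to the external field. -/
def iso {n : ℕ} (A : Matrix (Fin n) (Fin n) ℝ) (θ : Fin n → ℝ) (r : Fin n) (v : Fin n → ℝ) : ℝ :=
  ∫ z, Real.exp (-∑ j ∈ Finset.univ.erase r, v j * ((z r : ℤ) : ℝ) * ((z j : ℤ) : ℝ)
    - v r * ((z r : ℤ) : ℝ)) ∂(isingLaw A θ)

/-- The true parameters at the vertex `r`: `A r i` at `i ≠ r`, and `θ r` at `r`. -/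
def truth {n : ℕ} (A : Matrix (Fin n) (Fin n) ℝ) (θ : Fin n → ℝ) (r : Fin n) : Fin n → ℝ :=
  fun i => if i = r then θ r else A r i

/-- The index set of the `2n + 1` simplex coordinates: `inl i` is the coordinate `i`,
`inr (inl i)` the coordinate `n + i`, and `inr (inr ())` the coordinate `2n + 1`. -/
abbrev Coord (n : ℕ) : Type := Fin n ⊕ (Fin n ⊕ Unit)

/-- The simplex of radius `W`. -/
def simplex (n : ℕ) (W : ℝ) : Set (Coord n → ℝ) := {w | (∀ k, 0 ≤ w k) ∧ ∑ k, w k = W}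

/-- The map `w ↦ (w_i - w_{n+i})_i` from the simplex to the `ℓ₁` ball. -/
def toBall {n : ℕ} (w : Coord n → ℝ) : Fin n → ℝ :=
  fun i => w (Sum.inl i) - w (Sum.inr (Sum.inl i))

/-- The factor `(exp (-v_j X_r X_j) - p_j) / (1 - p_j)`. -/
def missFactor {n : ℕ} (p : Fin n → unitInterval) (r : Fin n) (v : Fin n → ℝ) (x : Fin n → ℤ)
    (j : Fin n) : ℝ :=
  (Real.exp (-v j * (x r : ℝ) * (x j : ℝ)) - (p j : ℝ)) / (1 - (p j : ℝ))

/-- The estimators `g^i`, as functions of `v = toBall w`. -/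
def gMiss {n : ℕ} (p : Fin n → unitInterval) (r : Fin n) (v : Fin n → ℝ) (x : Fin n → ℤ)
    (i : Fin n) : ℝ :=
  if i = r then
    -(Real.exp (-v r * (x r : ℝ)) * (x r : ℝ) / (1 - (p r : ℝ)))
      * ∏ j ∈ Finset.univ.erase r, missFactor p r v x j
  else
    -(Real.exp (-v r * (x r : ℝ)) * (x r : ℝ) / (1 - (p r : ℝ)))
      * (Real.exp (-v i * (x r : ℝ) * (x i : ℝ)) * (x i : ℝ) / (1 - (p i : ℝ)))
      * ∏ j ∈ (Finset.univ.erase r).erase i, missFactor p r v x j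

/-- The gradient estimator `G(w; x) = ∑_i g^i(w; x) (e^i - e^{n+i})`. -/
def gradMiss {n : ℕ} (p : Fin n → unitInterval) (r : Fin n) (w : Coord n → ℝ) (x : Fin n → ℤ) :
    Coord n → ℝ
  | Sum.inl i => gMiss p r (toBall w) x i
  | Sum.inr (Sum.inl i) => -gMiss p r (toBall w) x i
  | Sum.inr (Sum.inr _) => 0

/-- One step of stochastic multiplicative gradient descent on the simplex of radius `W` with step
size `η` and gradient estimate `g`. -/
def smgStep {n : ℕ} (η W : ℝ) (w g : Coord n → ℝ) : Coord n → ℝ :=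
  fun k => w k * (1 - η * g k + η * ((∑ l, w l * g l) / W))

/-- The iterates of the algorithm on the samples `X`: `smgIterate p r η W X t` is the point reached
after the first `t` samples (constant once the samples are used up). -/
def smgIterate {n T : ℕ} (p : Fin n → unitInterval) (r : Fin n) (η W : ℝ)
    (X : Fin T → Fin n → ℤ) : ℕ → Coord n → ℝ
  | 0 => fun _ => W / (2 * n + 1)
  | t + 1 =>
      if h : t < T then
        smgStep η W (smgIterate p r η W X t) (gradMiss p r (smgIterate p r η W X t) (X ⟨t, h⟩))
      else smgIterate p r η W X t

/-- The output of the algorithm: the average of the `T` points at which the gradient estimates were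
taken. -/
def smgOutput {n T : ℕ} (p : Fin n → unitInterval) (r : Fin n) (η W : ℝ)
    (X : Fin T → Fin n → ℤ) : Coord n → ℝ :=
  fun k => (1 / (T : ℝ)) * ∑ t ∈ Finset.range T, smgIterate p r η W X t k

end

end MissingIsing

/-! Three mechanisms carry the theorem.

Convexity: the remainder of the first-order expansion of the objective at the truth is the mean of a
positive weight times `e^{-x} - 1 + x`, where `x` is linear in the statistics `z_r z_j`, `z_r`
(`iso_sub_sub_grad`). As `|x| ≤ 2λ` and the weight is at least `e^{-λ}`, a multiple of the second
moment of `x` bounds it below. Reversing the spin at `i` moves `x` by `±2 d_i` and tilts the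
probability by a bounded factor, so this moment is at least `d_i² e^{-2λ}`
(`second_moment_lower_bound`).

Estimation: given the spins, the estimator is a product of functions of one mask bit each. The bits
are independent, so the mean is the product of the single means, and each single mean undoes the
erasure (`integral_gMiss`). The bound follows factor by factor, because the exponents share the
budget `λ`.

Recovery: the gradient vanishes at the truth, so convexity at each iterate gives `κ (v_i - A_ri)² ≤
⟨∇S(v), v - v*⟩` (`sq_le_isoGrad`). Summed over time, the right side is the regret along the sampled
gradients plus a martingale. The regret is bounded for every sample path by the potential `∑ u_k log
w_k` (`smg_regret_le`); the martingale by Hoeffding's lemma and an induction on the number of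
samples (`deviation_tail`). Cauchy-Schwarz passes to the averaged iterate. The rest is calibration
of the step size and of the constant `C`. -/

namespace MissingIsing

/-! ### Spins, flips and the energy -/

/-- The spin at `i` as a real number. -/
noncomputable def spin {n : ℕ} (z : Fin n → ℤˣ) (i : Fin n) : ℝ := ((z i : ℤ) : ℝ)

/-- The statistics `z_r z_j` (`j ≠ r`) and `z_r`, dual to the coordinates of the objective. -/
noncomputable def stat {n : ℕ} (r : Fin n) (z : Fin n → ℤˣ) (j : Fin n) : ℝ :=
  if j = r then spin z r else spin z r * spin z j

/-- The local field at the vertex `i`. -/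
noncomputable def localField {n : ℕ} (A : Matrix (Fin n) (Fin n) ℝ) (θ : Fin n → ℝ) (i : Fin n)
    (z : Fin n → ℤˣ) : ℝ := ∑ j, A i j * spin z j + θ i

/-- Reverse the spin at `i`. -/
def flip {n : ℕ} (i : Fin n) (z : Fin n → ℤˣ) : Fin n → ℤˣ := Function.update z i (-z i)

variable {n : ℕ} {A : Matrix (Fin n) (Fin n) ℝ} {θ : Fin n → ℝ} {lam : ℝ}

lemma spin_eq_or (z : Fin n → ℤˣ) (i : Fin n) : spin z i = 1 ∨ spin z i = -1 := by
  rcases Int.units_eq_one_or (z i) with h | h <;> simp [spin, h]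

lemma abs_spin (z : Fin n → ℤˣ) (i : Fin n) : |spin z i| = 1 := by
  rcases spin_eq_or z i with h | h <;> simp [h]

lemma abs_stat (r : Fin n) (z : Fin n → ℤˣ) (j : Fin n) : |stat r z j| = 1 := by
  unfold stat
  split_ifs <;> simp [abs_mul, abs_spin]

lemma spin_flip_self (z : Fin n → ℤˣ) (i : Fin n) : spin (flip i z) i = -spin z i := by
  simp [spin, flip]

lemma spin_flip_of_ne {i j : Fin n} (h : j ≠ i) (z : Fin n → ℤˣ) :
    spin (flip i z) j = spin z j := by
  simp [spin, flip, h]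

lemma flip_flip (i : Fin n) (z : Fin n → ℤˣ) : flip i (flip i z) = z := by
  simp [flip]

lemma sum_flip (i : Fin n) (f : (Fin n → ℤˣ) → ℝ) : ∑ z, f (flip i z) = ∑ z, f z :=
  Equiv.sum_comp (Function.Involutive.toPerm (flip i) (flip_flip i)) f

lemma stat_flip_root (r : Fin n) (z : Fin n → ℤˣ) (j : Fin n) :
    stat r (flip r z) j = -stat r z j := by
  unfold stat
  split_ifs with h
  · exact spin_flip_self z r
  · rw [spin_flip_self, spin_flip_of_ne h]; ring

lemma spin_flip (i : Fin n) (z : Fin n → ℤˣ) (j : Fin n) :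
    spin (flip i z) j = spin z j - (if j = i then 2 * spin z i else 0) := by
  split_ifs with h
  · subst h; rw [spin_flip_self]; ring
  · rw [spin_flip_of_ne h]; ring

/-- The symmetric double sum does not see the order of the vertices, so a flip can be expanded
without splitting at `i`. -/
lemma energy_eq (hA : A.IsSymm) (hd : ∀ i, A i i = 0) (z : Fin n → ℤˣ) :
    energy A θ z = (∑ i, ∑ j, A i j * spin z i * spin z j) / 2 + ∑ i, θ i * spin z i := by
  have h1 : ∑ i, ∑ j, A i j * spin z i * spin z j
      = ∑ i, ∑ j ∈ Finset.Ioi i, A i j * spin z i * spin z j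
        + ∑ i, ∑ j ∈ Finset.Iio i, A i j * spin z i * spin z j := by
    rw [← Finset.sum_add_distrib]
    refine Finset.sum_congr rfl fun i _ => ?_
    have hu : (Finset.univ : Finset (Fin n)) = insert i (Finset.Ioi i ∪ Finset.Iio i) := by
      ext j; simp only [Finset.mem_univ, Finset.mem_insert, Finset.mem_union, Finset.mem_Ioi,
        Finset.mem_Iio, true_iff]
      rcases lt_trichotomy i j with h | h | h
      · exact Or.inr (Or.inl h)
      · exact Or.inl h.symm
      · exact Or.inr (Or.inr h)
    rw [hu, Finset.sum_insert (by simp), Finset.sum_union, hd]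
    · ring
    · rw [Finset.disjoint_left]; intro j h1 h2
      exact lt_asymm (Finset.mem_Ioi.1 h1) (Finset.mem_Iio.1 h2)
  have h2 : ∑ i, ∑ j ∈ Finset.Iio i, A i j * spin z i * spin z j
      = ∑ i, ∑ j ∈ Finset.Ioi i, A i j * spin z i * spin z j := by
    rw [Finset.sum_comm' (t' := Finset.univ) (s' := fun j => Finset.Ioi j) (by simp)]
    refine Finset.sum_congr rfl fun i _ => Finset.sum_congr rfl fun j _ => ?_
    rw [hA.apply i j]; ring
  rw [h1, h2]
  unfold energy spin
  ring

lemma energy_flip (hA : A.IsSymm) (hd : ∀ i, A i i = 0) (i : Fin n) (z : Fin n → ℤˣ) :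
    energy A θ (flip i z) = energy A θ z - 2 * spin z i * localField A θ i z := by
  rw [energy_eq hA hd, energy_eq hA hd]
  simp only [spin_flip, localField]
  have e1 : ∀ a, ∑ b, A a b * (spin z a - if a = i then 2 * spin z i else 0)
      * (spin z b - if b = i then 2 * spin z i else 0)
      = ∑ b, A a b * spin z a * spin z b - A a i * spin z a * (2 * spin z i)
        - (if a = i then 2 * spin z i else 0) * ∑ b, A a b * spin z b
        + (if a = i then 2 * spin z i else 0) * (2 * spin z i) * A a i := by
    intro a
    have : ∀ b, A a b * (spin z a - if a = i then 2 * spin z i else 0)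
      * (spin z b - if b = i then 2 * spin z i else 0)
      = A a b * spin z a * spin z b
        - (if b = i then A a b * spin z a * (2 * spin z i) else 0)
        - (if a = i then 2 * spin z i else 0) * (A a b * spin z b)
        + (if b = i then (if a = i then 2 * spin z i else 0) * (2 * spin z i) * A a b else 0) := by
      intro b; split_ifs <;> ring
    simp only [this, Finset.sum_add_distrib, Finset.sum_sub_distrib, Finset.sum_ite_eq',
      Finset.mem_univ, if_true, Finset.mul_sum]
  have e2 : ∑ a, A a i * spin z a * (2 * spin z i)
      = 2 * spin z i * ∑ a, A i a * spin z a := by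
    rw [Finset.mul_sum]
    refine Finset.sum_congr rfl fun a _ => ?_
    rw [hA.apply i a]; ring
  have e3 : ∀ a, θ a * (spin z a - if a = i then 2 * spin z i else 0)
      = θ a * spin z a - (if a = i then θ a * (2 * spin z i) else 0) := by
    intro a; split_ifs <;> ring
  simp only [e1, e3, Finset.sum_add_distrib, Finset.sum_sub_distrib, e2, ite_mul, zero_mul,
    Finset.sum_ite_eq', Finset.mem_univ, if_true, hd]
  ring

lemma localField_flip (hd : ∀ i, A i i = 0) (i : Fin n) (z : Fin n → ℤˣ) :
    localField A θ i (flip i z) = localField A θ i z := by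
  unfold localField
  congr 1
  refine Finset.sum_congr rfl fun j _ => ?_
  by_cases h : j = i
  · subst h; simp [hd]
  · rw [spin_flip_of_ne h]

lemma row_le_width (i : Fin n) : ∑ j, |A i j| + |θ i| ≤ width A θ :=
  le_ciSup (f := fun i => ∑ j, |A i j| + |θ i|) (Set.finite_range _).bddAbove i

lemma abs_localField_le (hw : width A θ ≤ lam) (i : Fin n) (z : Fin n → ℤˣ) :
    |localField A θ i z| ≤ lam := by
  refine le_trans ?_ ((row_le_width i).trans hw)
  unfold localField
  refine (abs_add_le _ _).trans (add_le_add_left ((Finset.abs_sum_le_sum_abs _ _).trans ?_) _)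
  exact Finset.sum_le_sum fun j _ => by rw [abs_mul, abs_spin, mul_one]

lemma sum_abs_truth_le (hd : ∀ i, A i i = 0) (hw : width A θ ≤ lam) (r : Fin n) :
    ∑ i, |truth A θ r i| ≤ lam := by
  refine le_trans ?_ ((row_le_width r).trans hw)
  have h : ∀ i, |truth A θ r i| ≤ |A r i| + if i = r then |θ r| else 0 := by
    intro i
    unfold truth
    split_ifs with h
    · subst h; simp [hd]
    · simp
  refine (Finset.sum_le_sum fun i _ => h i).trans ?_
  simp [Finset.sum_add_distrib]

lemma abs_sum_mul_stat_le (r : Fin n) (v : Fin n → ℝ) (z : Fin n → ℤˣ) :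
    |∑ j, v j * stat r z j| ≤ ∑ j, |v j| :=
  (Finset.abs_sum_le_sum_abs _ _).trans
    (Finset.sum_le_sum fun j _ => by rw [abs_mul, abs_stat, mul_one])

/-- At the truth the exponent is exactly the part of the energy that involves the spin at `r`; the
objective's weight therefore cancels that part. -/
lemma sum_truth_mul_stat (hd : ∀ i, A i i = 0) (r : Fin n) (z : Fin n → ℤˣ) :
    ∑ j, truth A θ r j * stat r z j = spin z r * localField A θ r z := by
  have h : ∀ j, truth A θ r j * stat r z j
      = spin z r * (A r j * spin z j) + if j = r then spin z r * θ r else 0 := by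
    intro j
    unfold truth stat
    split_ifs with h
    · subst h; rw [hd]; ring
    · ring
  simp only [h, Finset.sum_add_distrib, localField, mul_add, Finset.mul_sum]
  simp

lemma iso_exponent (r : Fin n) (v : Fin n → ℝ) (z : Fin n → ℤˣ) :
    -∑ j ∈ Finset.univ.erase r, v j * ((z r : ℤ) : ℝ) * ((z j : ℤ) : ℝ) - v r * ((z r : ℤ) : ℝ)
      = -∑ j, v j * stat r z j := by
  rw [← Finset.add_sum_erase _ _ (Finset.mem_univ r)]
  have : ∑ j ∈ Finset.univ.erase r, v j * stat r z j
      = ∑ j ∈ Finset.univ.erase r, v j * ((z r : ℤ) : ℝ) * ((z j : ℤ) : ℝ) :=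
    Finset.sum_congr rfl fun j hj => by
      simp [stat, spin, Finset.ne_of_mem_erase hj, mul_assoc]
  rw [this]
  simp [stat, spin]
  ring

/-! ### The objective as a finite sum, and its gradient -/

/-- The partition function. -/
noncomputable def partition (A : Matrix (Fin n) (Fin n) ℝ) (θ : Fin n → ℝ) : ℝ :=
  ∑ z, Real.exp (energy A θ z)

lemma partition_pos : 0 < partition A θ :=
  Finset.sum_pos (fun _ _ => Real.exp_pos _) Finset.univ_nonempty

lemma isingLaw_real_singleton (z : Fin n → ℤˣ) :
    (isingLaw A θ).real {z} = Real.exp (energy A θ z) / partition A θ := by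
  rw [measureReal_def, isingLaw, PMF.toMeasure_apply_singleton _ _ (MeasurableSet.of_discrete),
    isingPMF, PMF.normalize_apply, tsum_fintype,
    ← ENNReal.ofReal_sum_of_nonneg fun _ _ => (Real.exp_pos _).le, ← partition, ENNReal.toReal_mul,
    ENNReal.toReal_ofReal (Real.exp_pos _).le, ENNReal.toReal_inv,
    ENNReal.toReal_ofReal (partition_pos (A := A) (θ := θ)).le, div_eq_mul_inv]

lemma integral_isingLaw (f : (Fin n → ℤˣ) → ℝ) :
    ∫ z, f z ∂(isingLaw A θ) = (∑ z, Real.exp (energy A θ z) * f z) / partition A θ := by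
  rw [integral_fintype (Integrable.of_finite), Finset.sum_div]
  refine Finset.sum_congr rfl fun z _ => ?_
  rw [isingLaw_real_singleton, smul_eq_mul]
  ring

lemma iso_eq (r : Fin n) (v : Fin n → ℝ) :
    iso A θ r v = ∫ z, Real.exp (-∑ j, v j * stat r z j) ∂(isingLaw A θ) := by
  unfold iso
  simp only [iso_exponent]

/-- The partial derivatives of the objective. -/
noncomputable def isoGrad (A : Matrix (Fin n) (Fin n) ℝ) (θ : Fin n → ℝ) (r : Fin n)
    (v : Fin n → ℝ) (i : Fin n) : ℝ :=
  -∫ z, Real.exp (-∑ j, v j * stat r z j) * stat r z i ∂(isingLaw A θ)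

lemma hasFDerivAt_iso (r : Fin n) (v : Fin n → ℝ) :
    HasFDerivAt (iso A θ r) (∑ i, isoGrad A θ r v i •
      ContinuousLinearMap.proj (R := ℝ) (φ := fun _ : Fin n => ℝ) i) v := by
  have h0 : iso A θ r = fun v => (∑ z, Real.exp (energy A θ z) *
      Real.exp (-∑ j, v j * stat r z j)) / partition A θ := by
    funext v; rw [iso_eq, integral_isingLaw]
  rw [h0]
  have h1 : ∀ z : Fin n → ℤˣ, HasFDerivAt (fun v : Fin n → ℝ => -∑ j, v j * stat r z j)
      (-∑ j, stat r z j • ContinuousLinearMap.proj (R := ℝ) (φ := fun _ : Fin n => ℝ) j) v := by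
    intro z
    refine HasFDerivAt.neg (HasFDerivAt.fun_sum fun j _ => ?_)
    exact (hasFDerivAt_apply j v).mul_const (stat r z j)
  have h2 := (HasFDerivAt.fun_sum (u := Finset.univ) fun z _ =>
    ((h1 z).exp).const_mul (Real.exp (energy A θ z))).mul_const (partition A θ)⁻¹
  simp only [div_eq_mul_inv]
  refine h2.congr_fderiv ?_
  ext x
  simp only [isoGrad, integral_isingLaw, _root_.sum_apply,
    _root_.smul_apply, ContinuousLinearMap.proj_apply, smul_eq_mul,
    _root_.neg_apply, Finset.mul_sum, Finset.sum_mul, div_eq_mul_inv,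
    ← Finset.sum_neg_distrib]
  rw [Finset.sum_comm]
  refine Finset.sum_congr rfl fun z _ => Finset.sum_congr rfl fun i _ => ?_
  ring

/-- After the cancellation at the truth the weight is invariant under the flip at `r`, whereas every
statistic changes sign, so the sum equals its own negative. -/
lemma isoGrad_truth (hA : A.IsSymm) (hd : ∀ i, A i i = 0) (r i : Fin n) :
    isoGrad A θ r (truth A θ r) i = 0 := by
  rw [isoGrad, integral_isingLaw, neg_eq_zero, div_eq_zero_iff]
  left
  set f : (Fin n → ℤˣ) → ℝ := fun z => Real.exp (energy A θ z) *
    (Real.exp (-∑ j, truth A θ r j * stat r z j) * stat r z i) with hf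
  have h : ∀ z, f (flip r z) = -f z := by
    intro z
    simp only [hf, sum_truth_mul_stat hd, stat_flip_root, energy_flip hA hd, spin_flip_self,
      localField_flip hd]
    rw [mul_neg, mul_neg, ← mul_assoc, ← mul_assoc, ← Real.exp_add, ← Real.exp_add]
    congr 3
    ring
  have h2 := sum_flip r f
  simp only [h, Finset.sum_neg_distrib] at h2
  linarith

/-! ### Restricted strong convexity -/

/-- A second-order lower bound for the exponential. -/
lemma sq_div_le_exp_neg_sub_one_add (x : ℝ) :
    x ^ 2 / (2 + |x|) ≤ Real.exp (-x) - 1 + x := by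
  rw [div_le_iff₀ (by positivity)]
  rcases le_total 0 x with hx | hx
  · rw [abs_of_nonneg hx]
    -- With the denominator cleared, the claim for `x ≥ 0` reads `e^{-x} (2 + x) + x ≥ 2`; the left
    -- side equals `2` at `0` and is monotone.
    have hder : ∀ y : ℝ, HasDerivAt (fun y : ℝ => Real.exp (-y) * (2 + y) + y)
        (1 - Real.exp (-y) * (1 + y)) y := by
      intro y
      refine ((((hasDerivAt_neg y).exp).fun_mul ((hasDerivAt_id' y).const_add 2)).fun_add
        (hasDerivAt_id' y)).congr_deriv ?_
      ring
    have hmono : Monotone (fun y : ℝ => Real.exp (-y) * (2 + y) + y) := by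
      refine monotone_of_deriv_nonneg (fun y => (hder y).differentiableAt) fun y => ?_
      rw [(hder y).deriv, sub_nonneg]
      calc Real.exp (-y) * (1 + y) ≤ Real.exp (-y) * Real.exp y :=
            mul_le_mul_of_nonneg_left (by linarith [Real.add_one_le_exp y]) (Real.exp_pos _).le
        _ = 1 := by rw [← Real.exp_add]; simp
    have := hmono hx
    simp only [neg_zero, Real.exp_zero] at this
    nlinarith
  · rw [abs_of_nonpos hx]
    have := Real.quadratic_le_exp_of_nonneg (neg_nonneg.2 hx)
    nlinarith [mul_le_mul_of_nonneg_right this (show 0 ≤ 2 + -x by linarith), pow_nonneg (neg_nonneg.2 hx) 3]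

/-- Two values at distance `2|d|` with weights `a`, `b` have weighted square sum at least `4 d² ab /
(a + b)`, whatever their centre; then `ab = 1` and `a + b ≤ 2M`. -/
lemma two_point_variance_le {a b M d x y : ℝ} (ha : 0 < a) (hb : 0 < b) (hab : a * b = 1)
    (haM : a ≤ M) (hbM : b ≤ M) (hxy : (x - y) ^ 2 = 4 * d ^ 2) :
    d ^ 2 / M ^ 2 * (a + b) ≤ a * x ^ 2 + b * y ^ 2 := by
  have hM : 0 < M := ha.trans_le haM
  have h1 : 4 * d ^ 2 ≤ (a + b) * (a * x ^ 2 + b * y ^ 2) := by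
    have : (a + b) * (a * x ^ 2 + b * y ^ 2) - (a * b) * (x - y) ^ 2 = (a * x + b * y) ^ 2 := by
      ring
    rw [hab, hxy] at this
    nlinarith [sq_nonneg (a * x + b * y)]
  have h2 : (a + b) ^ 2 ≤ 4 * M ^ 2 := by nlinarith
  have h3 : (a + b) * (d ^ 2 * (a + b)) ≤ (a + b) * ((a * x ^ 2 + b * y ^ 2) * M ^ 2) := by
    nlinarith [mul_le_mul_of_nonneg_left h2 (sq_nonneg d),
      mul_le_mul_of_nonneg_left h1 (sq_nonneg M)]
  rw [div_mul_eq_mul_div, div_le_iff₀ (by positivity)]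
  exact le_of_mul_le_mul_left h3 (by positivity)

lemma sum_mul_stat_flip {r i : Fin n} (hi : i ≠ r) (d : Fin n → ℝ) (z : Fin n → ℤˣ) :
    ∑ j, d j * stat r (flip i z) j = ∑ j, d j * stat r z j - 2 * d i * stat r z i := by
  have h : ∀ j, d j * stat r (flip i z) j
      = d j * stat r z j - if j = i then 2 * d j * stat r z j else 0 := by
    intro j
    unfold stat
    rw [spin_flip_of_ne hi.symm, spin_flip]
    by_cases h : j = i
    · subst h; simp [hi]; ring
    · simp [h]
  simp only [h, Finset.sum_sub_distrib, Finset.sum_ite_eq', Finset.mem_univ, if_true]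

/-- Configurations are paired by the flip at `i`. Up to a common factor the two weights of a pair
are `e^t` and `e^{-t}` with `|t| ≤ lam`, so the two-point bound applies with `M = e^lam`. -/
lemma second_moment_lower_bound (hA : A.IsSymm) (hd : ∀ i, A i i = 0) (hw : width A θ ≤ lam)
    {r i : Fin n} (hi : i ≠ r) (d : Fin n → ℝ) :
    d i ^ 2 * Real.exp (-2 * lam) ≤ ∫ z, (∑ j, d j * stat r z j) ^ 2 ∂(isingLaw A θ) := by
  rw [integral_isingLaw, le_div_iff₀ partition_pos, partition]
  have h2 : ∀ f : (Fin n → ℤˣ) → ℝ, ∑ z, f z = (∑ z, (f z + f (flip i z))) / 2 := by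
    intro f; rw [Finset.sum_add_distrib, sum_flip]; ring
  rw [Finset.mul_sum, h2, h2 (fun z => Real.exp (energy A θ z) * _)]
  refine div_le_div_of_nonneg_right (Finset.sum_le_sum fun z _ => ?_) (by norm_num)
  rw [energy_flip hA hd, sum_mul_stat_flip hi]
  set t := spin z i * localField A θ i z with ht
  have htl : |t| ≤ lam := by
    rw [ht, abs_mul, abs_spin, one_mul]; exact abs_localField_le hw i z
  obtain ⟨ht1, ht2⟩ := abs_le.1 htl
  set x := ∑ j, d j * stat r z j
  have key := two_point_variance_le (a := Real.exp t) (b := Real.exp (-t)) (M := Real.exp lam)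
    (d := d i) (x := x) (y := x - 2 * d i * stat r z i) (Real.exp_pos _) (Real.exp_pos _)
    (by rw [← Real.exp_add]; simp) (Real.exp_le_exp.2 ht2) (Real.exp_le_exp.2 (by linarith))
    (by
      have : stat r z i ^ 2 = 1 := by rw [← sq_abs, abs_stat, one_pow]
      linear_combination 4 * d i ^ 2 * this)
  have hM : (d i) ^ 2 / Real.exp lam ^ 2 = d i ^ 2 * Real.exp (-2 * lam) := by
    rw [div_eq_mul_inv, ← Real.exp_nat_mul, ← Real.exp_neg]; congr 2; push_cast; ring
  rw [hM] at key
  have e1 : Real.exp (energy A θ z) = Real.exp (energy A θ z - t) * Real.exp t := by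
    rw [← Real.exp_add]; congr 1; ring
  have e2 : Real.exp (energy A θ z - 2 * spin z i * localField A θ i z)
      = Real.exp (energy A θ z - t) * Real.exp (-t) := by
    rw [← Real.exp_add]; congr 1; rw [ht]; ring
  rw [e1, e2]
  have := mul_le_mul_of_nonneg_left key (Real.exp_pos (energy A θ z - t)).le
  linarith

lemma isoGrad_sum (r : Fin n) (v d : Fin n → ℝ) :
    ∑ i, isoGrad A θ r v i * d i
      = -∫ z, Real.exp (-∑ j, v j * stat r z j) * ∑ j, d j * stat r z j ∂(isingLaw A θ) := by
  simp only [isoGrad, integral_isingLaw, Finset.mul_sum, neg_mul, Finset.sum_neg_distrib,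
    div_mul_eq_mul_div, ← Finset.sum_div, Finset.sum_mul]
  rw [Finset.sum_comm]
  congr 2
  refine Finset.sum_congr rfl fun z _ => Finset.sum_congr rfl fun i _ => ?_
  ring

lemma iso_sub_sub_grad (r : Fin n) (v v₀ : Fin n → ℝ) :
    iso A θ r v - iso A θ r v₀ - ∑ i, isoGrad A θ r v₀ i * (v i - v₀ i)
      = ∫ z, Real.exp (-∑ j, v₀ j * stat r z j) *
          (Real.exp (-∑ j, (v j - v₀ j) * stat r z j) - 1 + ∑ j, (v j - v₀ j) * stat r z j)
          ∂(isingLaw A θ) := by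
  rw [isoGrad_sum, iso_eq, iso_eq, sub_neg_eq_add, ← integral_sub .of_finite .of_finite,
    ← integral_add .of_finite .of_finite]
  refine integral_congr_ae (ae_of_all _ fun z => ?_)
  have h : Real.exp (-∑ j, v j * stat r z j) = Real.exp (-∑ j, v₀ j * stat r z j) *
      Real.exp (-∑ j, (v j - v₀ j) * stat r z j) := by
    rw [← Real.exp_add]; congr 1
    simp only [sub_mul, Finset.sum_sub_distrib]; ring
  simp only [h]
  ring

lemma isoGrad_le_iso_sub (r : Fin n) (v v₀ : Fin n → ℝ) :
    ∑ i, isoGrad A θ r v₀ i * (v i - v₀ i) ≤ iso A θ r v - iso A θ r v₀ := by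
  rw [← sub_nonneg, iso_sub_sub_grad]
  refine integral_nonneg fun z => mul_nonneg (Real.exp_pos _).le ?_
  exact le_trans (by positivity) (sq_div_le_exp_neg_sub_one_add _)

lemma width_nonneg (r : Fin n) : 0 ≤ width A θ :=
  le_trans (by positivity) (row_le_width r)

/-- Restricted strong convexity, one coordinate at a time. -/
lemma restricted_strong_convexity (hA : A.IsSymm) (hd : ∀ i, A i i = 0) (hw : width A θ ≤ lam)
    (r : Fin n) {v : Fin n → ℝ} (hv : ∑ i, |v i| ≤ lam) {i : Fin n} (hi : i ≠ r) :
    Real.exp (-3 * lam) / (2 * (1 + lam)) * (v i - A r i) ^ 2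
      ≤ iso A θ r v - iso A θ r (truth A θ r)
        - ∑ i, isoGrad A θ r (truth A θ r) i * (v i - truth A θ r i) := by
  have hlam : 0 ≤ lam := (width_nonneg r).trans hw
  have ht := sum_abs_truth_le hd hw r
  rw [iso_sub_sub_grad]
  set d : Fin n → ℝ := fun j => v j - truth A θ r j with hdef
  have h1 := second_moment_lower_bound hA hd hw hi d
  have hdi : d i = v i - A r i := by simp [hdef, truth, hi]
  have hexp : Real.exp (-3 * lam) = Real.exp (-lam) * Real.exp (-2 * lam) := by
    rw [← Real.exp_add]; congr 1; ring
  calc Real.exp (-3 * lam) / (2 * (1 + lam)) * (v i - A r i) ^ 2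
      = Real.exp (-lam) / (2 * (1 + lam)) * (d i ^ 2 * Real.exp (-2 * lam)) := by
        rw [hexp, hdi]; ring
    _ ≤ Real.exp (-lam) / (2 * (1 + lam)) * ∫ z, (∑ j, d j * stat r z j) ^ 2 ∂(isingLaw A θ) :=
        mul_le_mul_of_nonneg_left h1 (by positivity)
    _ = ∫ z, Real.exp (-lam) / (2 * (1 + lam)) * (∑ j, d j * stat r z j) ^ 2 ∂(isingLaw A θ) :=
        (integral_const_mul _ _).symm
    _ ≤ _ := integral_mono .of_finite .of_finite fun z => ?_
  have hx : |∑ j, d j * stat r z j| ≤ 2 * lam := by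
    refine (abs_sum_mul_stat_le r d z).trans ?_
    calc ∑ j, |d j| ≤ ∑ j, (|v j| + |truth A θ r j|) :=
          Finset.sum_le_sum fun j _ => abs_sub _ _
      _ ≤ 2 * lam := by rw [Finset.sum_add_distrib]; linarith
  have h2 := sq_div_le_exp_neg_sub_one_add (∑ j, d j * stat r z j)
  have h3 : Real.exp (-lam) ≤ Real.exp (-∑ j, truth A θ r j * stat r z j) := by
    refine Real.exp_le_exp.2 (neg_le_neg ?_)
    exact (le_abs_self _).trans ((abs_sum_mul_stat_le r _ z).trans ht)
  have h4 : (∑ j, d j * stat r z j) ^ 2 / (2 * (1 + lam))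
      ≤ (∑ j, d j * stat r z j) ^ 2 / (2 + |∑ j, d j * stat r z j|) :=
    div_le_div_of_nonneg_left (sq_nonneg _) (by positivity) (by linarith)
  calc _ = Real.exp (-lam) * ((∑ j, d j * stat r z j) ^ 2 / (2 * (1 + lam))) := by ring
    _ ≤ _ := mul_le_mul h3 (h4.trans h2) (by positivity) (Real.exp_pos _).le

theorem iso_ge_of_sum_abs_le (hA : A.IsSymm) (hd : ∀ i, A i i = 0) (hw : width A θ ≤ lam)
    (r : Fin n) {v : Fin n → ℝ} (hv : ∑ i, |v i| ≤ lam) :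
    iso A θ r v - iso A θ r (truth A θ r) ≥
      fderiv ℝ (iso A θ r) (truth A θ r) (v - truth A θ r)
        + Real.exp (-3 * lam) / (2 * (1 + lam)) * ‖fun i : {i : Fin n // i ≠ r} => v i - A r i‖ ^ 2 := by
  have hf : fderiv ℝ (iso A θ r) (truth A θ r) (v - truth A θ r)
      = ∑ i, isoGrad A θ r (truth A θ r) i * (v i - truth A θ r i) := by
    rw [(hasFDerivAt_iso r _).fderiv]
    simp [_root_.sum_apply]
  rw [hf]
  -- With a single vertex there is no maximizing coordinate; the norm is zero and plain convexity
  -- suffices.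
  rcases isEmpty_or_nonempty {i : Fin n // i ≠ r} with h | h
  · rw [Subsingleton.elim (fun i : {i : Fin n // i ≠ r} => v i - A r i) 0, norm_zero]
    have := isoGrad_le_iso_sub (A := A) (θ := θ) r v (truth A θ r)
    linarith
  · obtain ⟨i, hi⟩ := Finite.exists_max fun i : {i : Fin n // i ≠ r} => |v i - A r i|
    have hn : ‖fun i : {i : Fin n // i ≠ r} => v i - A r i‖ ≤ |v i - A r i| :=
      (pi_norm_le_iff_of_nonneg (abs_nonneg _)).2 hi
    have h1 := restricted_strong_convexity hA hd hw r hv i.2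
    have hlam : 0 ≤ lam := (width_nonneg r).trans hw
    have h2 : ‖fun i : {i : Fin n // i ≠ r} => v i - A r i‖ ^ 2 ≤ (v i - A r i) ^ 2 := by
      rw [← sq_abs (v i - A r i)]
      exact pow_le_pow_left₀ (norm_nonneg _) hn 2
    have h3 := mul_le_mul_of_nonneg_left h2
      (show 0 ≤ Real.exp (-3 * lam) / (2 * (1 + lam)) by positivity)
    linarith

end MissingIsing

/-! ### The gradient estimator: mean and size -/

namespace MissingIsing

variable {n : ℕ} {A : Matrix (Fin n) (Fin n) ℝ} {θ : Fin n → ℝ}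

/-- The factors of the gradient estimator at the sample `applyMask (z, m)`, each a function of one
mask bit. -/
noncomputable def maskFactor (p : Fin n → unitInterval) (r : Fin n) (v : Fin n → ℝ)
    (z : Fin n → ℤˣ) (i j : Fin n) (b : Bool) : ℝ :=
  if j = r then
    if b then -(Real.exp (-v r * spin z r) * spin z r / (1 - (p r : ℝ))) else 0
  else if j = i then
    if b then Real.exp (-v i * spin z r * spin z i) * spin z i / (1 - (p i : ℝ)) else 0
  else
    if b then (Real.exp (-v j * spin z r * spin z j) - (p j : ℝ)) / (1 - (p j : ℝ)) else 1

lemma applyMask_cast (z : Fin n → ℤˣ) (m : Fin n → Bool) (i : Fin n) :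
    ((applyMask (z, m) i : ℤ) : ℝ) = if m i then spin z i else 0 := by
  unfold applyMask spin
  split_ifs <;> simp

lemma gMiss_applyMask {p : Fin n → unitInterval} (hp : ∀ i, (p i : ℝ) < 1) (r : Fin n)
    (v : Fin n → ℝ) (z : Fin n → ℤˣ) (m : Fin n → Bool) (i : Fin n) :
    gMiss p r v (applyMask (z, m)) i = ∏ j, maskFactor p r v z i j (m j) := by
  have hne : ∀ j, (1 - (p j : ℝ)) ≠ 0 := fun j => (sub_pos.2 (hp j)).ne'
  rw [← Finset.mul_prod_erase _ _ (Finset.mem_univ r)]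
  by_cases hm : m r
  · have hfac : ∀ j, j ≠ r → j ≠ i → missFactor p r v (applyMask (z, m)) j
        = maskFactor p r v z i j (m j) := by
      intro j hj hji
      unfold missFactor maskFactor
      rw [applyMask_cast, applyMask_cast, if_pos hm, if_neg hj, if_neg hji]
      by_cases hmj : m j <;> simp [hmj, hne j]
    have hr : maskFactor p r v z i r (m r)
        = -(Real.exp (-v r * spin z r) * spin z r / (1 - (p r : ℝ))) := by
      simp [maskFactor, hm]
    rw [hr]
    unfold gMiss
    rw [applyMask_cast, if_pos hm]
    by_cases hi : i = r
    · rw [if_pos hi]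
      congr 1
      refine Finset.prod_congr rfl fun j hj => ?_
      have hjr := Finset.ne_of_mem_erase hj
      exact hfac j hjr (by rw [hi]; exact hjr)
    · rw [if_neg hi, mul_assoc]
      rw [← Finset.mul_prod_erase (Finset.univ.erase r) _
        (Finset.mem_erase.2 ⟨hi, Finset.mem_univ i⟩)]
      congr 2
      · rw [applyMask_cast]
        by_cases hmi : m i <;> simp [maskFactor, hi, hmi]
      · refine Finset.prod_congr rfl fun j hj => ?_
        exact hfac j (Finset.ne_of_mem_erase (Finset.mem_of_mem_erase hj))
          (Finset.ne_of_mem_erase hj)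
  -- If the root is erased, the factor `x r = 0` annihilates both sides, so the other factors need
  -- not agree.
  · have h1 : maskFactor p r v z i r (m r) = 0 := by simp [maskFactor, hm]
    rw [h1, zero_mul]
    unfold gMiss
    rw [applyMask_cast, if_neg hm]
    simp

/-- An ordinary factor is `1` when erased and `(e^s - p)/(1 - p)` when observed, with mean `p + (e^s
- p) = e^s`. At `r` and `i` the erased value is `0` and the division by `1 - p` compensates. -/
lemma integral_maskFactor {p : Fin n → unitInterval} (hp : ∀ i, (p i : ℝ) < 1) (r : Fin n)
    (v : Fin n → ℝ) (z : Fin n → ℤˣ) (i j : Fin n) :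
    ∫ b, maskFactor p r v z i j b ∂(bernoulliMeasure false true (p j))
      = (if j = r then -1 else 1) * Real.exp (-(v j * stat r z j))
        * (if j = r then spin z r else if j = i then spin z i else 1) := by
  have hne : (1 - (p j : ℝ)) ≠ 0 := (sub_pos.2 (hp j)).ne'
  rw [integral_bernoulliMeasure]
  unfold maskFactor stat
  by_cases hj : j = r
  · subst hj
    simp
    field_simp
  · by_cases hi : j = i
    · subst hi
      simp [hj]
      field_simp
    · simp [hj, hi]
      field_simp
      ring_nf

lemma integral_gMiss {p : Fin n → unitInterval} (hp : ∀ i, (p i : ℝ) < 1) (r : Fin n)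
    (v : Fin n → ℝ) (i : Fin n) :
    ∫ x, gMiss p r v x i ∂(missLaw A θ p) = isoGrad A θ r v i := by
  rw [missLaw, integral_map Measurable.of_discrete.aemeasurable
    Measurable.of_discrete.aestronglyMeasurable, integral_prod _ .of_finite, isoGrad,
    ← integral_neg]
  refine integral_congr_ae (ae_of_all _ fun z => ?_)
  simp only [gMiss_applyMask hp]
  rw [integral_fintype_prod_eq_prod (f := fun j b => maskFactor p r v z i j b)]
  simp only [integral_maskFactor hp, Finset.prod_mul_distrib, Finset.prod_ite_eq',
    Finset.mem_univ, if_true, ← Real.exp_sum, Finset.sum_neg_distrib]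
  have h : ∏ j, (if j = r then spin z r else if j = i then spin z i else 1) = stat r z i := by
    rw [← Finset.mul_prod_erase _ _ (Finset.mem_univ r), if_pos rfl]
    have : ∀ j ∈ Finset.univ.erase r, (if j = r then spin z r else if j = i then spin z i else 1)
        = if j = i then spin z i else 1 := fun j hj => by rw [if_neg (Finset.ne_of_mem_erase hj)]
    rw [Finset.prod_congr rfl this, Finset.prod_ite_eq']
    unfold stat
    by_cases hi : i = r <;> simp [hi]
  rw [h]
  ring

/-- `toBall` as a continuous linear map. -/
noncomputable def toBallL (n : ℕ) : (Coord n → ℝ) →L[ℝ] (Fin n → ℝ) :=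
  ContinuousLinearMap.pi fun i =>
    ContinuousLinearMap.proj (R := ℝ) (φ := fun _ : Coord n => ℝ) (Sum.inl i)
      - ContinuousLinearMap.proj (R := ℝ) (φ := fun _ : Coord n => ℝ) (Sum.inr (Sum.inl i))

lemma sum_gradMiss_mul (p : Fin n → unitInterval) (r : Fin n) (w u : Coord n → ℝ)
    (x : Fin n → ℤ) :
    ∑ k, gradMiss p r w x k * u k = ∑ i, gMiss p r (toBall w) x i * toBall u i := by
  simp [Fintype.sum_sum_type, gradMiss, toBall, mul_add, Finset.sum_add_distrib, sub_eq_add_neg]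

theorem hasFDerivAt_iso_toBall {p : Fin n → unitInterval} (hp : ∀ i, (p i : ℝ) < 1) (r : Fin n)
    (w : Coord n → ℝ) :
    HasFDerivAt (fun u => iso A θ r (toBall u))
      (∑ k, (∫ x, gradMiss p r w x k ∂(missLaw A θ p)) •
        ContinuousLinearMap.proj (R := ℝ) (φ := fun _ : Coord n => ℝ) k) w := by
  refine ((hasFDerivAt_iso (A := A) (θ := θ) r (toBall w)).comp w
    (toBallL n).hasFDerivAt).congr_fderiv ?_
  ext u
  simp [_root_.sum_apply, Fintype.sum_sum_type, gradMiss, integral_gMiss hp, toBallL,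
    integral_neg, mul_add, Finset.sum_add_distrib, sub_eq_add_neg]

/-- The upper half is convexity of `exp` between `0` and `u = a/(1 - q)`: `e^{(1-p)u} ≤ p + (1 - p)
e^u`. This keeps the constant in front equal to `1`, so a product over all vertices costs no factor
depending on `n`. -/
lemma abs_exp_sub_div_le {p q s a : ℝ} (hp : 0 ≤ p) (hpq : p ≤ q) (hq : q < 1) (hs : |s| ≤ a) :
    |(Real.exp s - p) / (1 - p)| ≤ Real.exp (a / (1 - q)) := by
  have h1q : 0 < 1 - q := sub_pos.2 hq
  have h1p : 0 < 1 - p := by linarith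
  have ha : 0 ≤ a := (abs_nonneg s).trans hs
  obtain ⟨hs1, hs2⟩ := abs_le.1 hs
  set u := a / (1 - q) with hu
  have hu0 : 0 ≤ u := div_nonneg ha h1q.le
  have hau : a ≤ (1 - p) * u := by
    have : a = (1 - q) * u := by rw [hu]; field_simp
    nlinarith
  rw [abs_div, abs_of_pos h1p, div_le_iff₀ h1p, abs_le]
  constructor
  · have := Real.add_one_le_exp s
    have := Real.add_one_le_exp u
    nlinarith [mul_le_mul_of_nonneg_left this h1p.le]
  · have h1 : Real.exp s ≤ Real.exp ((1 - p) * u) := Real.exp_le_exp.2 (hs2.trans hau)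
    have h2 := convexOn_exp.2 (Set.mem_univ 0) (Set.mem_univ u) hp h1p.le (by ring)
    simp only [smul_eq_mul, mul_zero, zero_add, Real.exp_zero, mul_one] at h2
    linarith

lemma abs_exp_mul_div_le {p q s a c : ℝ} (hp : 0 ≤ p) (hpq : p ≤ q) (hq : q < 1) (hs : |s| ≤ a)
    (hc : |c| ≤ 1) :
    |Real.exp s * c / (1 - p)| ≤ 1 / (1 - q) * Real.exp (a / (1 - q)) := by
  have h1q : 0 < 1 - q := sub_pos.2 hq
  have h1p : 0 < 1 - p := by linarith
  have ha : 0 ≤ a := (abs_nonneg s).trans hs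
  have h1 : Real.exp s ≤ Real.exp (a / (1 - q)) := by
    refine Real.exp_le_exp.2 (((le_abs_self s).trans hs).trans ?_)
    rw [le_div_iff₀ h1q]
    nlinarith
  rw [abs_div, abs_mul, abs_of_pos (Real.exp_pos _), abs_of_pos h1p, one_div_mul_eq_div]
  have h2 : Real.exp s * |c| ≤ Real.exp (a / (1 - q)) :=
    (mul_le_of_le_one_right (Real.exp_pos _).le hc).trans h1
  exact div_le_div₀ (Real.exp_pos _).le h2 h1q (by linarith)

/-- The exponents `|v j|/(1 - pmax)` add up to at most `lam/(1 - pmax)`; only the factors at `r` and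
`i` contribute an extra `1/(1 - pmax)`. -/
lemma abs_gMiss_le {p : Fin n → unitInterval} {pmax lam : ℝ} (r : Fin n)
    (hq : pmax < 1) (hp : ∀ i, (p i : ℝ) ≤ pmax) {v : Fin n → ℝ} (hv : ∑ i, |v i| ≤ lam)
    {x : Fin n → ℤ} (hx : ∀ i, x i = -1 ∨ x i = 0 ∨ x i = 1) (i : Fin n) :
    |gMiss p r v x i| ≤ 1 / (1 - pmax) ^ 2 * Real.exp (lam / (1 - pmax)) := by
  have h1q : 0 < 1 - pmax := sub_pos.2 hq
  have hq0 : 0 ≤ pmax := (p r).2.1.trans (hp r)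
  have hx1 : ∀ i, |(x i : ℝ)| ≤ 1 := by
    intro i; rcases hx i with h | h | h <;> simp [h]
  have hxr : |-v r * (x r : ℝ)| ≤ |v r| := by
    rw [abs_mul, abs_neg]; exact mul_le_of_le_one_right (abs_nonneg _) (hx1 r)
  have hxj : ∀ j, |-v j * (x r : ℝ) * (x j : ℝ)| ≤ |v j| := by
    intro j
    rw [abs_mul, abs_mul, abs_neg]
    exact (mul_le_of_le_one_right (by positivity) (hx1 j)).trans
      (mul_le_of_le_one_right (abs_nonneg _) (hx1 r))
  have hprod : ∀ s : Finset (Fin n), |∏ j ∈ s, missFactor p r v x j|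
      ≤ ∏ j ∈ s, Real.exp (|v j| / (1 - pmax)) := by
    intro s
    rw [Finset.abs_prod]
    exact Finset.prod_le_prod (fun _ _ => abs_nonneg _)
      fun j _ => abs_exp_sub_div_le (p j).2.1 (hp j) hq (hxj j)
  have hall : ∏ j, Real.exp (|v j| / (1 - pmax)) ≤ Real.exp (lam / (1 - pmax)) := by
    rw [← Real.exp_sum, ← Finset.sum_div]
    exact Real.exp_le_exp.2 (div_le_div_of_nonneg_right hv h1q.le)
  have hfr := abs_exp_mul_div_le (p r).2.1 (hp r) hq hxr (hx1 r)
  have h1 : 1 ≤ 1 / (1 - pmax) := (one_le_div h1q).2 (by linarith)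
  rw [← Finset.mul_prod_erase _ _ (Finset.mem_univ r)] at hall
  unfold gMiss
  split_ifs with hi
  · rw [abs_mul, abs_neg]
    calc _ ≤ (1 / (1 - pmax) * Real.exp (|v r| / (1 - pmax)))
          * ∏ j ∈ Finset.univ.erase r, Real.exp (|v j| / (1 - pmax)) :=
          mul_le_mul hfr (hprod _) (abs_nonneg _) (by positivity)
      _ = 1 / (1 - pmax) * (Real.exp (|v r| / (1 - pmax))
          * ∏ j ∈ Finset.univ.erase r, Real.exp (|v j| / (1 - pmax))) := by ring
      _ ≤ 1 / (1 - pmax) * Real.exp (lam / (1 - pmax)) :=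
          mul_le_mul_of_nonneg_left hall (by positivity)
      _ ≤ 1 / (1 - pmax) ^ 2 * Real.exp (lam / (1 - pmax)) := by
          refine mul_le_mul_of_nonneg_right ?_ (Real.exp_pos _).le
          rw [← one_div_pow]
          nlinarith
  · have hfi := abs_exp_mul_div_le (p i).2.1 (hp i) hq (hxj i) (hx1 i)
    rw [← Finset.mul_prod_erase (Finset.univ.erase r) _
        (Finset.mem_erase.2 ⟨hi, Finset.mem_univ i⟩)] at hall
    rw [abs_mul, abs_mul, abs_neg]
    calc _ ≤ (1 / (1 - pmax) * Real.exp (|v r| / (1 - pmax)))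
          * (1 / (1 - pmax) * Real.exp (|v i| / (1 - pmax)))
          * ∏ j ∈ (Finset.univ.erase r).erase i, Real.exp (|v j| / (1 - pmax)) :=
          mul_le_mul (mul_le_mul hfr hfi (abs_nonneg _) (by positivity)) (hprod _)
            (abs_nonneg _) (by positivity)
      _ = 1 / (1 - pmax) ^ 2 * (Real.exp (|v r| / (1 - pmax)) * (Real.exp (|v i| / (1 - pmax))
          * ∏ j ∈ (Finset.univ.erase r).erase i, Real.exp (|v j| / (1 - pmax)))) := by
          rw [← one_div_pow]; ring
      _ ≤ _ := mul_le_mul_of_nonneg_left hall (by positivity)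

lemma sum_abs_toBall_le {lam : ℝ} {w : Coord n → ℝ} (hw : w ∈ simplex n lam) :
    ∑ i, |toBall w i| ≤ lam := by
  obtain ⟨h0, h1⟩ := hw
  have h : ∀ i, |toBall w i| ≤ w (Sum.inl i) + w (Sum.inr (Sum.inl i)) := by
    intro i
    have h1 := h0 (Sum.inl i)
    have h2 := h0 (Sum.inr (Sum.inl i))
    unfold toBall
    rw [abs_le]; constructor <;> linarith
  refine (Finset.sum_le_sum fun i _ => h i).trans ?_
  rw [← h1, Fintype.sum_sum_type, Fintype.sum_sum_type, Finset.sum_add_distrib]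
  have := h0 (Sum.inr (Sum.inr ()))
  simp only [Finset.univ_unique, PUnit.default_eq_unit, Finset.sum_singleton]
  linarith

theorem norm_gradMiss_le {p : Fin n → unitInterval} {pmax lam : ℝ} (r : Fin n)
    (hq : pmax < 1) (hp : ∀ i, (p i : ℝ) ≤ pmax) {w : Coord n → ℝ} (hw : w ∈ simplex n lam)
    {x : Fin n → ℤ} (hx : ∀ i, x i = -1 ∨ x i = 0 ∨ x i = 1) :
    ‖gradMiss p r w x‖ ≤ 1 / (1 - pmax) ^ 2 * Real.exp (lam / (1 - pmax)) := by
  have hB := abs_gMiss_le r hq hp (sum_abs_toBall_le hw) hx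
  refine (pi_norm_le_iff_of_nonneg ((abs_nonneg _).trans (hB r))).2 ?_
  rintro (i | i | i)
  · exact hB i
  · simpa [gradMiss] using hB i
  · simpa [gradMiss] using (abs_nonneg _).trans (hB r)

lemma ae_missLaw_mem (p : Fin n → unitInterval) :
    ∀ᵐ x ∂(missLaw A θ p), ∀ i, x i = -1 ∨ x i = 0 ∨ x i = 1 := by
  rw [missLaw, ae_map_iff Measurable.of_discrete.aemeasurable MeasurableSet.of_discrete]
  refine ae_of_all _ fun zc i => ?_
  unfold applyMask
  rcases Int.units_eq_one_or (zc.1 i) with h | h <;> by_cases hb : zc.2 i <;> simp [h, hb]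

end MissingIsing

/-! ### Recursions driven by independent inputs -/

namespace MissingIsing

section Recursion

/-- The states reached from `s` by feeding the inputs `X` one after another to the transition
function `F` (constant once the inputs are used up). -/
def run {S Ω : Type*} (F : S → Ω → S) (s : S) {T : ℕ} (X : Fin T → Ω) : ℕ → S
  | 0 => s
  | t + 1 => if h : t < T then F (run F s X t) (X ⟨t, h⟩) else run F s X t

/-- Peeling off the first input leaves a run of the same kind from another state, which is what an
induction with arbitrary starting state needs. -/
lemma run_cons {S Ω : Type*} (F : S → Ω → S) (s : S) {T : ℕ} (x : Ω) (X : Fin T → Ω) (t : ℕ) :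
    run F s (Fin.cons x X : Fin (T + 1) → Ω) (t + 1) = run F (F s x) X t := by
  induction t with
  | zero => simp [run]
  | succ t ih =>
    rw [run, ih]
    by_cases h : t < T
    · rw [dif_pos (Nat.succ_lt_succ h), run, dif_pos h]
      rfl
    · rw [dif_neg (fun h' => h (Nat.lt_of_succ_lt_succ h')), run, dif_neg h]

lemma run_mem {S Ω : Type*} {F : S → Ω → S} {good : Set S} {ok : Set Ω}
    (hF : ∀ s ∈ good, ∀ x ∈ ok, F s x ∈ good) {s : S} (hs : s ∈ good) {T : ℕ} {X : Fin T → Ω}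
    (hX : ∀ t, X t ∈ ok) (t : ℕ) : run F s X t ∈ good := by
  induction t with
  | zero => exact hs
  | succ t ih =>
    rw [run]
    split_ifs with h
    · exact hF _ ih _ (hX _)
    · exact ih

/-- The exponential moment of an adapted sum along independent inputs is at most the product of
uniform bounds on the one-step exponential moments. -/
lemma lintegral_exp_sum_run_le {S Ω : Type*} [MeasurableSpace Ω] [Countable Ω]
    [MeasurableSingletonClass Ω] (μ : Measure Ω) [IsProbabilityMeasure μ] {F : S → Ω → S}
    {φ : S → Ω → ℝ} {good : Set S} {c : ℝ} (hF : ∀ s ∈ good, ∀ᵐ x ∂μ, F s x ∈ good)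
    (hφ : ∀ s ∈ good, ∫⁻ x, ENNReal.ofReal (Real.exp (φ s x)) ∂μ ≤ ENNReal.ofReal (Real.exp c))
    (T : ℕ) {s : S} (hs : s ∈ good) :
    ∫⁻ X, ENNReal.ofReal (Real.exp (∑ t : Fin T, φ (run F s X t) (X t)))
        ∂(Measure.pi fun _ : Fin T => μ) ≤ ENNReal.ofReal (Real.exp (c * T)) := by
  induction T generalizing s with
  | zero => simp
  | succ T ih =>
    have hmp := (measurePreserving_piFinSuccAbove (fun _ : Fin (T + 1) => μ) 0).symm
    rw [← hmp.lintegral_comp_emb (MeasurableEquiv.measurableEmbedding _),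
      lintegral_prod _ Measurable.of_discrete.aemeasurable]
    have hsum : ∀ (x : Ω) (X : Fin T → Ω),
        ∑ t : Fin (T + 1), φ (run F s (Fin.cons x X : Fin (T + 1) → Ω) t) ((Fin.cons x X : Fin (T + 1) → Ω) t)
          = φ s x + ∑ t : Fin T, φ (run F (F s x) X t) (X t) := by
      intro x X
      rw [Fin.sum_univ_succ]
      simp only [Fin.val_zero, run, Fin.cons_zero, Fin.val_succ, run_cons, Fin.cons_succ]
    have hcons : ∀ (x : Ω) (X : Fin T → Ω),
        (MeasurableEquiv.piFinSuccAbove (fun _ : Fin (T + 1) => Ω) 0).symm (x, X)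
          = (Fin.cons x X : Fin (T + 1) → Ω) := by
      intro x X
      simp [MeasurableEquiv.piFinSuccAbove]
      rfl
    simp only [hcons, hsum, Real.exp_add, ENNReal.ofReal_mul (Real.exp_pos _).le]
    calc _ = ∫⁻ x, ENNReal.ofReal (Real.exp (φ s x)) *
          ∫⁻ X, ENNReal.ofReal (Real.exp (∑ t : Fin T, φ (run F (F s x) X t) (X t)))
            ∂(Measure.pi fun _ : Fin T => μ) ∂μ := by
          refine lintegral_congr fun x => ?_
          exact lintegral_const_mul _ Measurable.of_discrete
      _ ≤ ∫⁻ x, ENNReal.ofReal (Real.exp (φ s x)) * ENNReal.ofReal (Real.exp (c * T)) ∂μ := by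
          refine lintegral_mono_ae ?_
          filter_upwards [hF s hs] with x hx
          exact mul_le_mul_right (ih hx) _
      _ ≤ ENNReal.ofReal (Real.exp c) * ENNReal.ofReal (Real.exp (c * T)) := by
          rw [lintegral_mul_const _ Measurable.of_discrete]
          exact mul_le_mul_left (hφ s hs) _
      _ = _ := by
          rw [← ENNReal.ofReal_mul (Real.exp_pos _).le, ← Real.exp_add]
          congr 2; push_cast; ring

end Recursion

/-! ### Regret of multiplicative gradient descent -/

section Step

variable {n : ℕ} {η W B : ℝ} {w g u : Coord n → ℝ}

lemma abs_sum_mul_le_of_simplex (hw : w ∈ simplex n W) (hg : ∀ k, |g k| ≤ B) :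
    |∑ k, w k * g k| ≤ W * B := by
  rw [← hw.2, Finset.sum_mul]
  refine (Finset.abs_sum_le_sum_abs _ _).trans (Finset.sum_le_sum fun k _ => ?_)
  rw [abs_mul, abs_of_nonneg (hw.1 k)]
  exact mul_le_mul_of_nonneg_left (hg k) (hw.1 k)

lemma abs_smgStep_increment_le (hη : 0 ≤ η) (hW : 0 < W) (hw : w ∈ simplex n W)
    (hg : ∀ k, |g k| ≤ B) (k : Coord n) :
    |η * (g k - (∑ l, w l * g l) / W)| ≤ 2 * (η * B) := by
  have hC : |(∑ l, w l * g l) / W| ≤ B := by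
    rw [abs_div, abs_of_pos hW, div_le_iff₀ hW, mul_comm]
    exact abs_sum_mul_le_of_simplex hw hg
  rw [abs_mul, abs_of_nonneg hη]
  have := (abs_sub (g k) ((∑ l, w l * g l) / W)).trans (add_le_add (hg k) hC)
  nlinarith

lemma smgStep_eq (k : Coord n) :
    smgStep η W w g k = w k * (1 - η * (g k - (∑ l, w l * g l) / W)) := by
  unfold smgStep; ring

/-- The shift by the `w`-average of `g` preserves total mass, and each factor is at least `1/2`, so
no projection is needed. -/
lemma smgStep_mem (hη : 0 ≤ η) (hW : 0 < W) (hηB : 4 * (η * B) ≤ 1) (hg : ∀ k, |g k| ≤ B)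
    (hw : w ∈ simplex n W) (hpos : ∀ k, 0 < w k) :
    smgStep η W w g ∈ simplex n W ∧ ∀ k, 0 < smgStep η W w g k := by
  have hpos' : ∀ k, 0 < smgStep η W w g k := by
    intro k
    rw [smgStep_eq]
    have := (abs_le.1 (abs_smgStep_increment_le hη hW hw hg k)).2
    exact mul_pos (hpos k) (by linarith)
  refine ⟨⟨fun k => (hpos' k).le, ?_⟩, hpos'⟩
  have h : ∀ k, smgStep η W w g k = w k - η * (w k * g k) + w k * (η * ((∑ l, w l * g l) / W)) := by
    intro k; unfold smgStep; ring
  simp only [h, Finset.sum_add_distrib, Finset.sum_sub_distrib, ← Finset.mul_sum,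
    ← Finset.sum_mul, hw.2]
  field_simp
  ring

lemma neg_sub_le_log_one_sub {x : ℝ} (hx : |x| ≤ 1 / 2) : -x - 2 * x ^ 2 ≤ Real.log (1 - x) := by
  obtain ⟨h1, h2⟩ := abs_le.1 hx
  have hpos : 0 < 1 - x := by linarith
  refine le_trans ?_ (Real.one_sub_inv_le_log_of_pos hpos)
  rw [← sub_nonneg]
  have : 1 - (1 - x)⁻¹ - (-x - 2 * x ^ 2) = x ^ 2 * (1 - 2 * x) / (1 - x) := by
    field_simp; ring
  rw [this]
  exact div_nonneg (mul_nonneg (sq_nonneg x) (by linarith)) hpos.le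

/-- The potential `∑ u_k log w_k` changes by `∑ u_k log (1 - x_k)`. The linear part of the logarithm
is exactly the regret term, and `2 x_k² ≤ 8 (ηB)²` is the loss. -/
lemma smgStep_regret_le (hη : 0 ≤ η) (hW : 0 < W) (hηB : 4 * (η * B) ≤ 1) (hg : ∀ k, |g k| ≤ B)
    (hw : w ∈ simplex n W) (hpos : ∀ k, 0 < w k) (hu : u ∈ simplex n W) :
    η * ∑ k, g k * (w k - u k)
      ≤ ∑ k, u k * Real.log (smgStep η W w g k) - ∑ k, u k * Real.log (w k)
        + 8 * (η * B) ^ 2 * W := by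
  set C := (∑ l, w l * g l) / W with hC
  have hx : ∀ k, |η * (g k - C)| ≤ 2 * (η * B) := abs_smgStep_increment_le hη hW hw hg
  have hk : ∀ k, u k * (-(η * (g k - C)) - 8 * (η * B) ^ 2)
      ≤ u k * Real.log (smgStep η W w g k) - u k * Real.log (w k) := by
    intro k
    have hxk := (abs_le.1 (hx k)).2
    rw [smgStep_eq, Real.log_mul (hpos k).ne' (by linarith), ← mul_sub]
    refine mul_le_mul_of_nonneg_left ?_ (hu.1 k)
    have h1 := neg_sub_le_log_one_sub ((hx k).trans (by linarith))
    have h2 : (η * (g k - C)) ^ 2 ≤ (2 * (η * B)) ^ 2 := by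
      rw [← sq_abs]; exact pow_le_pow_left₀ (abs_nonneg _) (hx k) 2
    linarith
  have hs := Finset.sum_le_sum fun k (_ : k ∈ Finset.univ) => hk k
  rw [Finset.sum_sub_distrib] at hs
  have e1 : ∑ k, u k * (-(η * (g k - C)) - 8 * (η * B) ^ 2)
      = η * ∑ k, g k * (w k - u k) - 8 * (η * B) ^ 2 * W := by
    have h : ∀ k, u k * (-(η * (g k - C)) - 8 * (η * B) ^ 2)
        = (η * C - 8 * (η * B) ^ 2) * u k - η * (g k * u k) := by intro k; ring
    have hCW : C * W = ∑ k, g k * w k := by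
      rw [hC, div_mul_cancel₀ _ hW.ne']
      exact Finset.sum_congr rfl fun k _ => mul_comm _ _
    rw [Finset.sum_congr rfl fun k _ => h k, Finset.sum_sub_distrib, ← Finset.mul_sum,
      ← Finset.mul_sum, hu.2]
    simp only [mul_sub, Finset.sum_sub_distrib, ← hCW]
    ring
  linarith

/-- The regret of multiplicative gradient descent on the simplex. -/
lemma smg_regret_le (hη : 0 < η) (hW : 0 < W) (hηB : 4 * (η * B) ≤ 1) {w g : ℕ → Coord n → ℝ}
    {T : ℕ} (h0 : ∀ k, w 0 k = W / (2 * n + 1))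
    (hstep : ∀ t < T, w (t + 1) = smgStep η W (w t) (g t))
    (hw : ∀ t, w t ∈ simplex n W ∧ ∀ k, 0 < w t k) (hg : ∀ t < T, ∀ k, |g t k| ≤ B)
    (hu : u ∈ simplex n W) :
    ∑ t ∈ Finset.range T, ∑ k, g t k * (w t k - u k)
      ≤ W * Real.log (2 * n + 1) / η + 8 * η * B ^ 2 * W * T := by
  have h1 : η * ∑ t ∈ Finset.range T, ∑ k, g t k * (w t k - u k)
      ≤ ∑ k, u k * Real.log (w T k) - ∑ k, u k * Real.log (w 0 k) + 8 * (η * B) ^ 2 * W * T := by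
    rw [← Finset.sum_range_sub (fun t => ∑ k, u k * Real.log (w t k)), Finset.mul_sum,
      mul_comm _ (T : ℝ), ← nsmul_eq_mul, ← Finset.card_range T, ← Finset.sum_const,
      Finset.card_range, ← Finset.sum_add_distrib]
    refine Finset.sum_le_sum fun t ht => ?_
    have ht := Finset.mem_range.1 ht
    rw [hstep t ht]
    exact smgStep_regret_le hη.le hW hηB (hg t ht) (hw t).1 (hw t).2 hu
  -- The potential never exceeds `W log W`, and the uniform start lies only `W log (2n + 1)` below
  -- that.
  have h2 : ∑ k, u k * Real.log (w T k) ≤ W * Real.log W := by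
    rw [← hu.2, Finset.sum_mul]
    refine Finset.sum_le_sum fun k _ => mul_le_mul_of_nonneg_left ?_ (hu.1 k)
    refine Real.log_le_log ((hw T).2 k) ?_
    rw [hu.2, ← (hw T).1.2]
    exact Finset.single_le_sum (fun k _ => (hw T).1.1 k) (Finset.mem_univ k)
  have h3 : ∑ k, u k * Real.log (w 0 k) = W * (Real.log W - Real.log (2 * n + 1)) := by
    simp only [h0]
    rw [← Finset.sum_mul, hu.2, Real.log_div hW.ne' (by positivity)]
  have h4 : η * ∑ t ∈ Finset.range T, ∑ k, g t k * (w t k - u k)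
      ≤ η * (W * Real.log (2 * n + 1) / η + 8 * η * B ^ 2 * W * T) := by
    have : η * (W * Real.log (2 * n + 1) / η + 8 * η * B ^ 2 * W * T)
        = W * Real.log (2 * n + 1) + 8 * (η * B) ^ 2 * W * T := by field_simp
    rw [this]
    linarith
  exact le_of_mul_le_mul_left h4 hη

end Step

/-! ### The martingale increments of the algorithm -/

section Algorithm

variable {n : ℕ} {A : Matrix (Fin n) (Fin n) ℝ} {θ : Fin n → ℝ} {lam : ℝ}

lemma smgIterate_eq_run {T : ℕ} (p : Fin n → unitInterval) (r : Fin n) (η W : ℝ)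
    (X : Fin T → Fin n → ℤ) (t : ℕ) :
    smgIterate p r η W X t
      = run (fun w x => smgStep η W w (gradMiss p r w x)) (fun _ => W / (2 * n + 1)) X t := by
  induction t with
  | zero => rfl
  | succ t ih => rw [smgIterate, run, ih]

/-- The point of the simplex that represents the vector `v` of the `ℓ₁` ball. -/
noncomputable def toSimplex (lam : ℝ) (v : Fin n → ℝ) : Coord n → ℝ
  | Sum.inl i => max (v i) 0
  | Sum.inr (Sum.inl i) => max (-v i) 0
  | Sum.inr (Sum.inr _) => lam - ∑ i, |v i|

lemma toBall_toSimplex (v : Fin n → ℝ) : toBall (toSimplex lam v) = v := by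
  funext i
  simp only [toBall, toSimplex]
  rcases le_total 0 (v i) with h | h
  · rw [max_eq_left h, max_eq_right (by linarith)]; ring
  · rw [max_eq_right h, max_eq_left (by linarith)]; ring

/-- The last coordinate takes up the slack `lam - ‖v‖₁`; it is the reason for having `2n + 1`
coordinates. -/
lemma toSimplex_mem {v : Fin n → ℝ} (hv : ∑ i, |v i| ≤ lam) :
    toSimplex lam v ∈ simplex n lam := by
  constructor
  · rintro (i | i | i)
    · exact le_max_right _ _
    · exact le_max_right _ _
    · exact sub_nonneg.2 hv
  · have : ∀ i, |v i| = max (v i) 0 + max (-v i) 0 := by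
      intro i
      rcases le_total 0 (v i) with h | h
      · rw [max_eq_left h, max_eq_right (by linarith), abs_of_nonneg h]; ring
      · rw [max_eq_right h, max_eq_left (by linarith), abs_of_nonpos h]; ring
    simp only [Fintype.sum_sum_type, toSimplex, Finset.univ_unique, Finset.sum_singleton]
    rw [Finset.sum_congr rfl fun i _ => this i, Finset.sum_add_distrib]
    ring

/-- The exponential moment of one increment of the martingale that compares the stochastic and the
exact gradient along `w - u`. -/
lemma lintegral_exp_increment_le {p : Fin n → unitInterval} {r : Fin n} {B : ℝ}
    (hp : ∀ i, (p i : ℝ) < 1) {w u : Coord n → ℝ} (hw : w ∈ simplex n lam)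
    (hu : u ∈ simplex n lam)
    (hB : ∀ᵐ x ∂(missLaw A θ p), ∀ k, |gradMiss p r w x k| ≤ B) (s : ℝ) :
    ∫⁻ x, ENNReal.ofReal (Real.exp (s * (∑ i, isoGrad A θ r (toBall w) i *
        (toBall w i - toBall u i) - ∑ k, gradMiss p r w x k * (w k - u k)))) ∂(missLaw A θ p)
      ≤ ENNReal.ofReal (Real.exp (2 * (lam * B) ^ 2 * s ^ 2)) := by
  set Y : (Fin n → ℤ) → ℝ := fun x => -∑ k, gradMiss p r w x k * (w k - u k) with hY
  have hYb : ∀ᵐ x ∂(missLaw A θ p), Y x ∈ Set.Icc (-(2 * (lam * B))) (2 * (lam * B)) := by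
    filter_upwards [hB] with x hx
    have h1 := abs_le.1 (abs_sum_mul_le_of_simplex hw hx)
    have h2 := abs_le.1 (abs_sum_mul_le_of_simplex hu hx)
    have : Y x = ∑ k, u k * gradMiss p r w x k - ∑ k, w k * gradMiss p r w x k := by
      simp only [hY]
      rw [← Finset.sum_sub_distrib, ← Finset.sum_neg_distrib]
      exact Finset.sum_congr rfl fun k _ => by ring
    rw [this]
    constructor <;> linarith [h1.1, h1.2, h2.1, h2.2]
  have hg : ∀ i, Integrable (fun x => gMiss p r (toBall w) x i) (missLaw A θ p) := by
    intro i
    refine Integrable.of_bound Measurable.of_discrete.aestronglyMeasurable B ?_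
    filter_upwards [hB] with x hx
    exact hx (Sum.inl i)
  have hmean : ∫ x, Y x ∂(missLaw A θ p)
      = -∑ i, isoGrad A θ r (toBall w) i * (toBall w i - toBall u i) := by
    have : ∀ x, Y x = -∑ i, gMiss p r (toBall w) x i * (toBall w i - toBall u i) := by
      intro x
      have h := sum_gradMiss_mul p r w (w - u) x
      simp only [Pi.sub_apply] at h
      rw [hY]
      simp only [h]
      congr 1
      refine Finset.sum_congr rfl fun i _ => ?_
      simp only [toBall, Pi.sub_apply]; ring
    simp only [this]
    rw [integral_neg, integral_finsetSum _ fun i _ => (hg i).mul_const _]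
    simp only [integral_mul_const, integral_gMiss hp]
  -- Hoeffding's lemma on an interval of length `4 lam B`: the variance proxy is `(2 lam B)²`.
  have hsub := hasSubgaussianMGF_of_mem_Icc (μ := missLaw A θ p)
    (Measurable.of_discrete (f := Y)).aemeasurable hYb
  have hmgf := hsub.mgf_le s
  rw [mgf, hmean] at hmgf
  have hint := hsub.integrable_exp_mul s
  rw [hmean] at hint
  have hc : ((((‖2 * (lam * B) - -(2 * (lam * B))‖₊ / 2) ^ 2 : NNReal)) : ℝ) * s ^ 2 / 2
      = 2 * (lam * B) ^ 2 * s ^ 2 := by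
    push_cast
    rw [div_pow, Real.norm_eq_abs, sq_abs]
    ring
  rw [hc] at hmgf
  have heq : ∀ x, s * (Y x - -∑ i, isoGrad A θ r (toBall w) i * (toBall w i - toBall u i))
      = s * (∑ i, isoGrad A θ r (toBall w) i * (toBall w i - toBall u i)
        - ∑ k, gradMiss p r w x k * (w k - u k)) := by
    intro x; rw [hY]; ring
  simp only [heq] at hmgf hint
  rw [← ofReal_integral_eq_lintegral_ofReal hint (ae_of_all _ fun _ => (Real.exp_pos _).le)]
  exact ENNReal.ofReal_le_ofReal hmgf

end Algorithm
end MissingIsing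

/-! ### Error of the averaged iterate -/

namespace MissingIsing

section Recovery

variable {n : ℕ} {A : Matrix (Fin n) (Fin n) ℝ} {θ : Fin n → ℝ} {lam : ℝ}

/-- The bound on the gradient estimator. -/
noncomputable def gradBound (pmax lam : ℝ) : ℝ :=
  1 / (1 - pmax) ^ 2 * Real.exp (lam / (1 - pmax))

lemma gradBound_pos {pmax : ℝ} (hq : pmax < 1) : 0 < gradBound pmax lam := by
  have : 0 < 1 - pmax := sub_pos.2 hq
  unfold gradBound; positivity

lemma abs_gradMiss_le {p : Fin n → unitInterval} {pmax : ℝ} (r : Fin n)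
    (hq : pmax < 1) (hp : ∀ i, (p i : ℝ) ≤ pmax) {w : Coord n → ℝ} (hw : w ∈ simplex n lam)
    {x : Fin n → ℤ} (hx : ∀ i, x i = -1 ∨ x i = 0 ∨ x i = 1) (k : Coord n) :
    |gradMiss p r w x k| ≤ gradBound pmax lam :=
  (norm_le_pi_norm (gradMiss p r w x) k).trans (norm_gradMiss_le r hq hp hw hx)

/-- The iterates stay in the interior of the simplex, whatever the samples. -/
lemma smgIterate_mem {p : Fin n → unitInterval} {pmax η : ℝ} {r : Fin n} (hq : pmax < 1)
    (hp : ∀ i, (p i : ℝ) ≤ pmax) (hlam : 0 < lam) (hη : 0 ≤ η)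
    (hηB : 4 * (η * gradBound pmax lam) ≤ 1) {T : ℕ} {X : Fin T → Fin n → ℤ}
    (hX : ∀ t i, X t i = -1 ∨ X t i = 0 ∨ X t i = 1) (t : ℕ) :
    smgIterate p r η lam X t ∈ simplex n lam ∧ ∀ k, 0 < smgIterate p r η lam X t k := by
  rw [smgIterate_eq_run]
  refine run_mem (good := {w | w ∈ simplex n lam ∧ ∀ k, 0 < w k})
    (ok := {x | ∀ i, x i = -1 ∨ x i = 0 ∨ x i = 1}) (fun w hw x hx => ?_) ?_ hX t
  · exact smgStep_mem hη hlam hηB (abs_gradMiss_le r hq hp hw.1 hx) hw.1 hw.2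
  · refine ⟨⟨fun k => by positivity, ?_⟩, fun k => by positivity⟩
    simp [Fintype.card_sum]
    field_simp
    ring

lemma toBall_smgOutput {T : ℕ} (p : Fin n → unitInterval) (r : Fin n) (η W : ℝ)
    (X : Fin T → Fin n → ℤ) (i : Fin n) :
    toBall (smgOutput p r η W X) i
      = (1 / (T : ℝ)) * ∑ t ∈ Finset.range T, toBall (smgIterate p r η W X t) i := by
  simp only [toBall, smgOutput, Finset.sum_sub_distrib]
  ring

lemma mul_sq_mean_sub_le {T : ℕ} (hT : 0 < T) (f : ℕ → ℝ) (a : ℝ) :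
    (T : ℝ) * ((1 / (T : ℝ)) * ∑ t ∈ Finset.range T, f t - a) ^ 2
      ≤ ∑ t ∈ Finset.range T, (f t - a) ^ 2 := by
  have hT' : (0 : ℝ) < T := Nat.cast_pos.2 hT
  have h := sq_sum_le_card_mul_sum_sq (s := Finset.range T) (f := fun t => f t - a)
  rw [Finset.sum_sub_distrib, Finset.sum_const, Finset.card_range, nsmul_eq_mul] at h
  have e : (T : ℝ) * ((1 / (T : ℝ)) * ∑ t ∈ Finset.range T, f t - a) ^ 2
      = (∑ t ∈ Finset.range T, f t - T * a) ^ 2 / T := by field_simp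
  rw [e, div_le_iff₀ hT', mul_comm _ (T : ℝ)]
  exact h

/-- Strong convexity and first-order convexity, combined at the minimizer. -/
lemma sq_le_isoGrad (hA : A.IsSymm) (hd : ∀ i, A i i = 0) (hw : width A θ ≤ lam)
    (r : Fin n) {v : Fin n → ℝ} (hv : ∑ i, |v i| ≤ lam) {i : Fin n} (hi : i ≠ r) :
    Real.exp (-3 * lam) / (2 * (1 + lam)) * (v i - A r i) ^ 2
      ≤ ∑ j, isoGrad A θ r v j * (v j - truth A θ r j) := by
  have h1 := restricted_strong_convexity hA hd hw r hv hi
  simp only [isoGrad_truth hA hd, zero_mul, Finset.sum_const_zero, sub_zero] at h1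
  have h2 := isoGrad_le_iso_sub (A := A) (θ := θ) r (truth A θ r) v
  have h3 : ∑ j, isoGrad A θ r v j * (truth A θ r j - v j)
      = -∑ j, isoGrad A θ r v j * (v j - truth A θ r j) := by
    rw [← Finset.sum_neg_distrib]
    exact Finset.sum_congr rfl fun j _ => by ring
  linarith

/-- The error of the output in terms of the deviation of the stochastic gradients. -/
lemma output_error_le (hA : A.IsSymm) (hd : ∀ i, A i i = 0) (hw : width A θ ≤ lam)
    {p : Fin n → unitInterval} {pmax η m : ℝ} {r : Fin n} (hq : pmax < 1)
    (hp : ∀ i, (p i : ℝ) ≤ pmax) (hlam : 0 < lam) (hη : 0 < η)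
    (hηB : 4 * (η * gradBound pmax lam) ≤ 1) {T : ℕ} (hT : 0 < T) {X : Fin T → Fin n → ℤ}
    (hX : ∀ t i, X t i = -1 ∨ X t i = 0 ∨ X t i = 1)
    (hm : ∑ t : Fin T, (∑ i, isoGrad A θ r (toBall (smgIterate p r η lam X t)) i *
        (toBall (smgIterate p r η lam X t) i - truth A θ r i)
      - ∑ k, gradMiss p r (smgIterate p r η lam X t) (X t) k *
        (smgIterate p r η lam X t k - toSimplex lam (truth A θ r) k)) ≤ m)
    {i : Fin n} (hi : i ≠ r) :
    Real.exp (-3 * lam) / (2 * (1 + lam))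
        * (T * (toBall (smgOutput p r η lam X) i - A r i) ^ 2)
      ≤ lam * Real.log (2 * n + 1) / η + 8 * η * gradBound pmax lam ^ 2 * lam * T + m := by
  set w := smgIterate p r η lam X with hwdef
  set κ := Real.exp (-3 * lam) / (2 * (1 + lam)) with hκ
  have hκ0 : 0 ≤ κ := by positivity
  have hmem := smgIterate_mem (r := r) hq hp hlam hη.le hηB hX
  -- The regret bound takes sequences on `ℕ`; the value `0` beyond `T` is never used.
  set g : ℕ → Coord n → ℝ := fun t => if h : t < T then gradMiss p r (w t) (X ⟨t, h⟩) else 0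
    with hg
  have hreg := smg_regret_le (u := toSimplex lam (truth A θ r)) (w := w) (g := g) (T := T)
    hη hlam hηB (fun _ => rfl)
    (fun t ht => by rw [hwdef, smgIterate, dif_pos ht, ← hwdef, hg]; simp only [dif_pos ht])
    hmem
    (fun t ht => by
      rw [hg]; simp only [dif_pos ht]
      exact abs_gradMiss_le r hq hp (hmem t).1 (hX _))
    (toSimplex_mem (sum_abs_truth_le hd hw r))
  have hgt : ∀ t : Fin T, g t = gradMiss p r (w t) (X t) := by
    intro t; simp only [hg, dif_pos t.2]
  rw [Finset.sum_range] at hreg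
  simp only [hgt] at hreg
  rw [Finset.sum_sub_distrib] at hm
  have h1 := mul_sq_mean_sub_le hT (fun t => toBall (w t) i) (A r i)
  rw [Finset.sum_range (fun t => (toBall (w t) i - A r i) ^ 2)] at h1
  rw [toBall_smgOutput]
  calc _ ≤ κ * ∑ t : Fin T, (toBall (w t) i - A r i) ^ 2 := mul_le_mul_of_nonneg_left h1 hκ0
    _ = ∑ t : Fin T, κ * (toBall (w t) i - A r i) ^ 2 := Finset.mul_sum _ _ _
    _ ≤ ∑ t : Fin T, ∑ j, isoGrad A θ r (toBall (w t)) j * (toBall (w t) j - truth A θ r j) :=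
        Finset.sum_le_sum fun t _ =>
          sq_le_isoGrad hA hd hw r (sum_abs_toBall_le (hmem t).1) hi
    _ ≤ _ := by linarith

lemma ae_pi_missLaw_mem (p : Fin n → unitInterval) (T : ℕ) :
    ∀ᵐ X ∂(Measure.pi fun _ : Fin T => missLaw A θ p),
      ∀ t i, X t i = -1 ∨ X t i = 0 ∨ X t i = 1 := by
  rw [ae_all_iff]
  intro t
  exact (Measure.tendsto_eval_ae_ae (μ := fun _ : Fin T => missLaw A θ p) (i := t)).eventually
    (ae_missLaw_mem (A := A) (θ := θ) p)

/-- The deviation of the stochastic gradients along the trajectory. -/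
lemma deviation_tail (hd : ∀ i, A i i = 0) (hw : width A θ ≤ lam)
    {p : Fin n → unitInterval} {pmax η l : ℝ} {r : Fin n} (hq : pmax < 1)
    (hp : ∀ i, (p i : ℝ) ≤ pmax) (hlam : 0 < lam) (hη : 0 < η)
    (hηB : 4 * (η * gradBound pmax lam) ≤ 1) {T : ℕ} (hT : 0 < T) (hl : 0 < l) :
    (Measure.pi fun _ : Fin T => missLaw A θ p)
      {X | 3 * (lam * gradBound pmax lam) * Real.sqrt (T * l) <
        ∑ t : Fin T, (∑ i, isoGrad A θ r (toBall (smgIterate p r η lam X t)) i *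
          (toBall (smgIterate p r η lam X t) i - truth A θ r i)
        - ∑ k, gradMiss p r (smgIterate p r η lam X t) (X t) k *
          (smgIterate p r η lam X t k - toSimplex lam (truth A θ r) k))}
      ≤ ENNReal.ofReal (Real.exp (-l)) := by
  set u := toSimplex lam (truth A θ r) with hu
  have humem : u ∈ simplex n lam := toSimplex_mem (sum_abs_truth_le hd hw r)
  have hub : toBall u = truth A θ r := toBall_toSimplex _
  have hT' : (0 : ℝ) < T := Nat.cast_pos.2 hT
  set b := lam * gradBound pmax lam with hb
  have hb0 : 0 < b := mul_pos hlam (gradBound_pos hq)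
  set q := Real.sqrt (T * l) with hqdef
  have hq0 : 0 < q := Real.sqrt_pos.2 (mul_pos hT' hl)
  have hq2 : q ^ 2 = T * l := Real.sq_sqrt (mul_pos hT' hl).le
  -- With this `s` the threshold `3bq` becomes `2l`, while the exponential moment is at most
  -- `e^{8l/9} ≤ e^l`; Markov's inequality leaves `e^{-l}`.
  set s := 2 * l / (3 * b * q) with hs
  have hs0 : 0 < s := by positivity
  set F : (Coord n → ℝ) → (Fin n → ℤ) → (Coord n → ℝ) :=
    fun w x => smgStep η lam w (gradMiss p r w x) with hF
  set φ : (Coord n → ℝ) → (Fin n → ℤ) → ℝ := fun w x =>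
    s * (∑ i, isoGrad A θ r (toBall w) i * (toBall w i - toBall u i)
      - ∑ k, gradMiss p r w x k * (w k - u k)) with hφ
  have hmom := lintegral_exp_sum_run_le (missLaw A θ p) (F := F) (φ := φ)
    (good := {w | w ∈ simplex n lam ∧ ∀ k, 0 < w k}) (c := 2 * b ^ 2 * s ^ 2)
    (fun w hw' => by
      filter_upwards [ae_missLaw_mem (A := A) (θ := θ) p] with x hx
      exact smgStep_mem hη.le hlam hηB (abs_gradMiss_le r hq hp hw'.1 hx) hw'.1 hw'.2)
    (fun w hw' => lintegral_exp_increment_le (fun i => (hp i).trans_lt hq) hw'.1 humem (by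
      filter_upwards [ae_missLaw_mem (A := A) (θ := θ) p] with x hx
      exact abs_gradMiss_le r hq hp hw'.1 hx) s)
    T (s := fun _ => lam / (2 * n + 1))
    -- The empty run at time `0` shows that the uniform point is admissible.
    (smgIterate_mem (r := r) hq hp hlam hη.le hηB (T := 0) (X := Fin.elim0)
      (fun t => Fin.elim0 t) 0)
  have hcT : 2 * b ^ 2 * s ^ 2 * T ≤ l := by
    have : 2 * b ^ 2 * s ^ 2 * T = 8 / 9 * l := by
      rw [hs, div_pow, mul_pow (3 * b) q, hq2]
      field_simp
      ring
    linarith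
  have hmarkov := mul_meas_ge_le_lintegral (μ := Measure.pi fun _ : Fin T => missLaw A θ p)
    (f := fun X => ENNReal.ofReal (Real.exp (∑ t : Fin T,
      φ (run F (fun _ => lam / (2 * n + 1)) X t) (X t))))
    Measurable.of_discrete (ENNReal.ofReal (Real.exp (2 * l)))
  have hle := hmarkov.trans (hmom.trans (ENNReal.ofReal_le_ofReal (Real.exp_le_exp.2 hcT)))
  have hpos : ENNReal.ofReal (Real.exp (2 * l)) ≠ 0 := (ENNReal.ofReal_pos.2 (Real.exp_pos _)).ne'
  rw [mul_comm, ← ENNReal.le_div_iff_mul_le (Or.inl hpos) (Or.inl ENNReal.ofReal_ne_top),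
    ← ENNReal.ofReal_div_of_pos (Real.exp_pos _), ← Real.exp_sub] at hle
  rw [show -l = l - 2 * l by ring]
  refine (measure_mono ?_).trans hle
  intro X hX
  refine ENNReal.ofReal_le_ofReal (Real.exp_le_exp.2 ?_)
  simp only [hφ, ← Finset.mul_sum, hub, ← smgIterate_eq_run, hF]
  have h2 : 2 * l = s * (3 * b * q) := by rw [hs]; field_simp
  rw [h2]
  exact mul_le_mul_of_nonneg_left (le_of_lt hX) hs0.le

/-- The exceptional event concerns the whole trajectory and not a coordinate, so all `i` are handled
at once without a union bound. -/
theorem recovery_probability_ge (hA : A.IsSymm) (hd : ∀ i, A i i = 0) (hw : width A θ ≤ lam)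
    {p : Fin n → unitInterval} {pmax η l : ℝ} {r : Fin n} (hq : pmax < 1)
    (hp : ∀ i, (p i : ℝ) ≤ pmax) (hlam : 0 < lam) (hη : 0 < η)
    (hηB : 4 * (η * gradBound pmax lam) ≤ 1) {T : ℕ} (hT : 0 < T) (hl : 0 < l) :
    1 - Real.exp (-l) ≤ (Measure.pi fun _ : Fin T => missLaw A θ p).real
      {X | ∀ i, i ≠ r → Real.exp (-3 * lam) / (2 * (1 + lam))
        * (T * (toBall (smgOutput p r η lam X) i - A r i) ^ 2)
      ≤ lam * Real.log (2 * n + 1) / η + 8 * η * gradBound pmax lam ^ 2 * lam * T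
        + 3 * (lam * gradBound pmax lam) * Real.sqrt (T * l)} := by
  have htail := deviation_tail (r := r) hd hw hq hp hlam hη hηB hT hl
  set bad := {X : Fin T → Fin n → ℤ | 3 * (lam * gradBound pmax lam) * Real.sqrt (T * l) <
        ∑ t : Fin T, (∑ i, isoGrad A θ r (toBall (smgIterate p r η lam X t)) i *
          (toBall (smgIterate p r η lam X t) i - truth A θ r i)
        - ∑ k, gradMiss p r (smgIterate p r η lam X t) (X t) k *
          (smgIterate p r η lam X t k - toSimplex lam (truth A θ r) k))} with hbad
  have h1 : (Measure.pi fun _ : Fin T => missLaw A θ p).real bad ≤ Real.exp (-l) := by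
    rw [← ENNReal.toReal_ofReal (Real.exp_pos (-l)).le]
    exact ENNReal.toReal_mono ENNReal.ofReal_ne_top htail
  have h2 := probReal_compl_eq_one_sub (μ := Measure.pi fun _ : Fin T => missLaw A θ p)
    (MeasurableSet.of_discrete (s := bad))
  refine le_trans (b := (Measure.pi fun _ : Fin T => missLaw A θ p).real badᶜ) (by linarith)
    (ENNReal.toReal_mono (measure_ne_top _ _) (measure_mono_ae ?_))
  filter_upwards [ae_pi_missLaw_mem (A := A) (θ := θ) p T] with X hX hXb i hi
  exact output_error_le hA hd hw hq hp hlam hη hηB hT hX (not_lt.1 hXb) hi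

/-- The output is always within `2 * lam` of the true weights. -/
lemma ae_output_error_le_two_mul (hd : ∀ i, A i i = 0) (hw : width A θ ≤ lam)
    {p : Fin n → unitInterval} {pmax η : ℝ} (r : Fin n) (hq : pmax < 1)
    (hp : ∀ i, (p i : ℝ) ≤ pmax) (hlam : 0 < lam) (hη : 0 < η)
    (hηB : 4 * (η * gradBound pmax lam) ≤ 1) {T : ℕ} (hT : 0 < T) :
    ∀ᵐ X ∂(Measure.pi fun _ : Fin T => missLaw A θ p), ∀ i, i ≠ r →
      |toBall (smgOutput p r η lam X) i - A r i| ≤ 2 * lam := by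
  filter_upwards [ae_pi_missLaw_mem (A := A) (θ := θ) p T] with X hX i hi
  have hT' : (0 : ℝ) < T := Nat.cast_pos.2 hT
  have hcoord : ∀ {v : Fin n → ℝ}, ∑ j, |v j| ≤ lam → |v i| ≤ lam := fun hv =>
    (Finset.single_le_sum (fun j _ => abs_nonneg _) (Finset.mem_univ i)).trans hv
  have h1 : |A r i| ≤ lam := by
    have := hcoord (sum_abs_truth_le hd hw r)
    simpa [truth, hi] using this
  have h2 : |toBall (smgOutput p r η lam X) i| ≤ lam := by
    rw [toBall_smgOutput, abs_mul, abs_of_nonneg (by positivity), one_div_mul_eq_div,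
      div_le_iff₀ hT']
    refine (Finset.abs_sum_le_sum_abs _ _).trans ((Finset.sum_le_sum fun t _ =>
      hcoord (sum_abs_toBall_le (smgIterate_mem hq hp hlam hη.le hηB hX t).1)).trans ?_)
    simp [mul_comm]
  exact (abs_sub _ _).trans (by linarith)

/-! ### Step size and sample complexity -/

/-- The step size. -/
noncomputable def stepSize (n T : ℕ) (pmax lam : ℝ) : ℝ :=
  (if Real.log (2 * n + 1) ≤ T then Real.sqrt (Real.log (2 * n + 1) / T) else 1)
    / (4 * gradBound pmax lam)

lemma log_two_mul_add_one_pos {n : ℕ} (hn : 0 < n) : 0 < Real.log (2 * n + 1) := by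
  have : (1 : ℝ) ≤ n := by exact_mod_cast hn
  exact Real.log_pos (by linarith)

lemma stepSize_pos {n : ℕ} (hn : 0 < n) (T : ℕ) {pmax : ℝ} (hq : pmax < 1) :
    0 < stepSize n T pmax lam := by
  have hL := log_two_mul_add_one_pos hn
  have hB := gradBound_pos (lam := lam) hq
  unfold stepSize
  split_ifs with h
  · have : (0 : ℝ) < T := hL.trans_le h
    positivity
  · positivity

lemma four_mul_stepSize_le (n T : ℕ) {pmax : ℝ} (hq : pmax < 1) :
    4 * (stepSize n T pmax lam * gradBound pmax lam) ≤ 1 := by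
  have hB := gradBound_pos (lam := lam) hq
  have e : ∀ y : ℝ, 4 * (y / (4 * gradBound pmax lam) * gradBound pmax lam) = y := by
    intro y; field_simp
  unfold stepSize
  rw [e]
  split_ifs with h
  · exact Real.sqrt_le_one.2 (div_le_one_of_le₀ h (Nat.cast_nonneg T))
  · exact le_rfl

/-- With `L = log (2n + 1)` the two regret terms are `4` and `2` times `lam B √(LT)`. Since `L ≤
3l`, `√(LT) ≤ 2 √(Tl)`, and `6 · 2 + 3 = 15`. -/
lemma regret_stepSize_le {T : ℕ} (hn : 0 < n) {pmax l : ℝ} (hq : pmax < 1) (hlam : 0 < lam)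
    (hLT : Real.log (2 * n + 1) ≤ T) (hLl : Real.log (2 * n + 1) ≤ 3 * l) :
    lam * Real.log (2 * n + 1) / stepSize n T pmax lam
        + 8 * stepSize n T pmax lam * gradBound pmax lam ^ 2 * lam * T
        + 3 * (lam * gradBound pmax lam) * Real.sqrt (T * l)
      ≤ 15 * (lam * gradBound pmax lam) * Real.sqrt (T * l) := by
  have hL := log_two_mul_add_one_pos hn
  have hB := gradBound_pos (lam := lam) hq
  unfold stepSize
  rw [if_pos hLT]
  set L := Real.log (2 * n + 1)
  set B := gradBound pmax lam
  have hT : (0 : ℝ) < T := hL.trans_le hLT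
  set y := Real.sqrt (L / T) with hy
  have hy0 : 0 < y := Real.sqrt_pos.2 (div_pos hL hT)
  have hy2 : y ^ 2 * T = L := by
    rw [hy, Real.sq_sqrt (div_pos hL hT).le, div_mul_cancel₀ _ hT.ne']
  have h1 : y * T ≤ 2 * Real.sqrt (T * l) := by
    refine le_of_sq_le_sq ?_ (by positivity)
    have : Real.sqrt (T * l) ^ 2 = T * l := Real.sq_sqrt (mul_nonneg hT.le (by linarith))
    rw [mul_pow, mul_pow, this]
    have : y ^ 2 * (T : ℝ) ^ 2 = L * T := by rw [← hy2]; ring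
    nlinarith
  have e : lam * L / (y / (4 * B)) + 8 * (y / (4 * B)) * B ^ 2 * lam * T
      = 6 * (lam * B) * (y * T) := by
    rw [← hy2]; field_simp; ring
  rw [e]
  have := mul_le_mul_of_nonneg_left h1 (show 0 ≤ 6 * (lam * B) by positivity)
  linarith

lemma log_two_mul_add_one_le (hn : 2 ≤ n) {δ : ℝ} (hδ : 0 < δ) (hδ1 : δ < 1) :
    Real.log (2 * n + 1) ≤ 3 * Real.log (n / δ) := by
  have hn' : (2 : ℝ) ≤ n := by exact_mod_cast hn
  have h1 : Real.log (2 * n + 1) ≤ Real.log ((n : ℝ) ^ 3) :=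
    -- `2n + 1 ≤ n³` needs `n ≥ 2`.
    Real.log_le_log (by positivity) (by nlinarith [sq_nonneg ((n : ℝ) - 2)])
  have h2 : Real.log n ≤ Real.log (n / δ) :=
    Real.log_le_log (by positivity) ((le_div_iff₀ hδ).2 (by nlinarith))
  rw [Real.log_pow] at h1
  push_cast at h1
  linarith

/-- The constant in the exponent of the sample complexity. -/
noncomputable def rateConst (pmax lam₀ : ℝ) : ℝ :=
  2 * (3 + 1 / (1 - pmax) + 30 * (1 + 1 / lam₀) / (1 - pmax) ^ 2 / lam₀)

lemma rateConst_pos {pmax lam₀ : ℝ} (hq : pmax < 1) (h0 : 0 < lam₀) :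
    0 < rateConst pmax lam₀ := by
  have : 0 < 1 - pmax := sub_pos.2 hq
  unfold rateConst; positivity

/-- The prefactor `K` is absorbed into the exponent: `K ≤ e^{K lam/lam₀}` because `lam ≥ lam₀`.
Here, as in the bound on `(1 + lam)/lam`, the lower bound on `lam` is essential. -/
lemma exp_rateConst_ge {pmax lam₀ : ℝ} (hq : pmax < 1) (h0 : 0 < lam₀) (hlam : lam₀ ≤ lam) :
    30 * (1 + 1 / lam₀) / (1 - pmax) ^ 2 * Real.exp (3 * lam + lam / (1 - pmax))
      ≤ Real.exp (rateConst pmax lam₀ / 2 * lam) := by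
  have hq' : 0 < 1 - pmax := sub_pos.2 hq
  unfold rateConst
  set K := 30 * (1 + 1 / lam₀) / (1 - pmax) ^ 2 with hK
  have hK0 : 0 < K := by positivity
  have e : 2 * (3 + 1 / (1 - pmax) + K / lam₀) / 2 * lam
      = K * (lam / lam₀) + (3 * lam + lam / (1 - pmax)) := by field_simp; ring
  rw [e, Real.exp_add (K * (lam / lam₀))]
  refine mul_le_mul_of_nonneg_right ?_ (Real.exp_pos _).le
  have h1 : 1 ≤ lam / lam₀ := (one_le_div h0).2 hlam
  have h2 := Real.add_one_le_exp (K * (lam / lam₀))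
  nlinarith

lemma gradBound_le_rate {pmax lam₀ : ℝ} (hq : pmax < 1) (h0 : 0 < lam₀) (hlam : lam₀ ≤ lam) :
    15 * gradBound pmax lam
      ≤ Real.exp (-3 * lam) / (2 * (1 + lam)) * lam * Real.exp (rateConst pmax lam₀ / 2 * lam) := by
  have hl : 0 < lam := h0.trans_le hlam
  have hq' : 0 < 1 - pmax := sub_pos.2 hq
  have h1 := exp_rateConst_ge hq h0 hlam
  have h2 : 1 + lam ≤ lam * (1 + 1 / lam₀) := by
    have : 1 ≤ lam / lam₀ := (one_le_div h0).2 hlam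
    have e : lam * (1 + 1 / lam₀) = lam + lam / lam₀ := by ring
    rw [e]; linarith
  refine le_trans ?_ (mul_le_mul_of_nonneg_left h1 (by positivity))
  have e3 : Real.exp (-3 * lam) * Real.exp (3 * lam + lam / (1 - pmax))
      = Real.exp (lam / (1 - pmax)) := by rw [← Real.exp_add]; congr 1; ring
  have e : Real.exp (-3 * lam) / (2 * (1 + lam)) * lam * (30 * (1 + 1 / lam₀) / (1 - pmax) ^ 2
      * Real.exp (3 * lam + lam / (1 - pmax)))
      = 15 * gradBound pmax lam * (lam * (1 + 1 / lam₀) / (1 + lam)) := by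
    rw [gradBound, ← e3]; field_simp; ring
  rw [e]
  have := gradBound_pos (lam := lam) hq
  exact le_mul_of_one_le_right (by positivity) ((one_le_div (by positivity)).2 h2)

/-- The number is `16 · 3`: `16` from `ε⁴ < (2 lam)⁴` and `3` from `log (2n + 1) ≤ 3l`. It makes `T`
large enough for the square-root branch of the step size. -/
lemma forty_eight_le_exp_rateConst {pmax lam₀ : ℝ} (hq0 : 0 ≤ pmax) (hq : pmax < 1)
    (h0 : 0 < lam₀) (hlam : lam₀ ≤ lam) : 48 ≤ Real.exp (rateConst pmax lam₀ * lam) := by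
  have hl : 0 < lam := h0.trans_le hlam
  have hq' : 0 < 1 - pmax := sub_pos.2 hq
  have h1 := exp_rateConst_ge hq h0 hlam
  have h2 : 1 ≤ Real.exp (3 * lam + lam / (1 - pmax)) := Real.one_le_exp (by positivity)
  have h3 : 30 ≤ 30 * (1 + 1 / lam₀) / (1 - pmax) ^ 2 := by
    rw [le_div_iff₀ (by positivity)]
    have : 0 < 1 / lam₀ := by positivity
    nlinarith
  have e : Real.exp (rateConst pmax lam₀ * lam) = Real.exp (rateConst pmax lam₀ / 2 * lam) ^ 2 := by
    rw [← Real.exp_nat_mul]; congr 1; push_cast; ring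
  rw [e]
  have h4 : 30 ≤ Real.exp (rateConst pmax lam₀ / 2 * lam) := by nlinarith
  nlinarith

theorem recovery {pmax lam₀ : ℝ} (hq : pmax < 1) (h0 : 0 < lam₀) (r : Fin n)
    {p : Fin n → unitInterval} (hp : ∀ i, (p i : ℝ) ≤ pmax) (hlam : lam₀ ≤ lam)
    (hA : A.IsSymm) (hd : ∀ i, A i i = 0) (hw : width A θ ≤ lam) {ε δ : ℝ} (hε : 0 < ε)
    (hδ : 0 < δ) (hδ1 : δ < 1) {T : ℕ}
    (hT : lam ^ 4 * Real.log (n / δ) * Real.exp (rateConst pmax lam₀ * lam) * ε⁻¹ ^ 4 ≤ T) :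
    1 - δ ≤ (Measure.pi fun _ : Fin T => missLaw A θ p).real
      {X | ∀ i, i ≠ r →
        |toBall (smgOutput p r (stepSize n T pmax lam) lam X) i - A r i| ≤ ε} := by
  have hl0 : 0 < lam := h0.trans_le hlam
  have hn : 0 < n := Fin.pos r
  have hn' : (1 : ℝ) ≤ n := by exact_mod_cast hn
  have hlog : 0 < Real.log (n / δ) := Real.log_pos ((one_lt_div hδ).2 (by linarith))
  set l := Real.log (n / δ) with hl
  have hTpos : (0 : ℝ) < T := lt_of_lt_of_le (by positivity) hT
  have hT0 : 0 < T := Nat.cast_pos.1 hTpos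
  have hη := stepSize_pos (lam := lam) hn T hq
  have hηB := four_mul_stepSize_le (lam := lam) n T hq
  -- For large `ε` the sample bound need not give `log (2n + 1) ≤ T`, but the error never exceeds `2
  -- lam`.
  by_cases hεl : 2 * lam ≤ ε
  · have h1 : (Measure.pi fun _ : Fin T => missLaw A θ p).real Set.univ
        ≤ (Measure.pi fun _ : Fin T => missLaw A θ p).real {X | ∀ i, i ≠ r →
          |toBall (smgOutput p r (stepSize n T pmax lam) lam X) i - A r i| ≤ ε} := by
      refine ENNReal.toReal_mono (measure_ne_top _ _) (measure_mono_ae ?_)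
      filter_upwards [ae_output_error_le_two_mul (A := A) (θ := θ) hd hw r hq hp hl0 hη hηB hT0]
        with X hX _ i hi
      exact (hX i hi).trans hεl
    rw [probReal_univ] at h1
    linarith
  rw [not_le] at hεl
  by_cases hex : ∃ i, i ≠ r
  swap
  · have : {X : Fin T → Fin n → ℤ | ∀ i, i ≠ r →
        |toBall (smgOutput p r (stepSize n T pmax lam) lam X) i - A r i| ≤ ε} = Set.univ :=
      Set.eq_univ_of_forall fun X i hi => absurd ⟨i, hi⟩ hex
    rw [this, probReal_univ]
    linarith
  have hn2 : 2 ≤ n := by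
    obtain ⟨i, hi⟩ := hex
    have := Fin.val_ne_of_ne hi
    omega
  have hLl : Real.log (2 * n + 1) ≤ 3 * l := log_two_mul_add_one_le hn2 hδ hδ1
  set D := Real.exp (rateConst pmax lam₀ / 2 * lam) with hD
  have hD0 : 0 < D := Real.exp_pos _
  have hD2 : Real.exp (rateConst pmax lam₀ * lam) = D ^ 2 := by
    rw [hD, ← Real.exp_nat_mul]; congr 1; push_cast; ring
  have h48 := forty_eight_le_exp_rateConst ((p r).2.1.trans (hp r)) hq h0 hlam
  rw [hD2] at hT h48
  have hTε : lam ^ 4 * l * D ^ 2 ≤ T * ε ^ 4 := by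
    rwa [inv_pow, ← div_eq_mul_inv, div_le_iff₀ (by positivity)] at hT
  have hLT : Real.log (2 * n + 1) ≤ T := by
    have h1 : ε ^ 4 ≤ (2 * lam) ^ 4 := pow_le_pow_left₀ hε.le hεl.le 4
    have h2 : lam ^ 4 * (l * D ^ 2) ≤ lam ^ 4 * (16 * T) := by
      have := mul_le_mul_of_nonneg_left h1 hTpos.le
      linarith
    have h3 := le_of_mul_le_mul_left h2 (by positivity)
    have h4 := mul_le_mul_of_nonneg_left h48 hlog.le
    linarith
  have hR := regret_stepSize_le hn hq hl0 hLT hLl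
  have hprob := recovery_probability_ge (r := r) hA hd hw hq hp hl0 hη hηB hT0 hlog
  have hexp : Real.exp (-l) ≤ δ := by
    rw [Real.exp_neg, hl, Real.exp_log (by positivity), inv_div]
    exact div_le_self hδ.le hn'
  refine le_trans (by linarith) (hprob.trans (measureReal_mono ?_))
  intro X hX i hi
  have hXi := (hX i hi).trans hR
  set κ := Real.exp (-3 * lam) / (2 * (1 + lam)) with hκ
  have hκ0 : 0 < κ := by positivity
  set s := Real.sqrt (T * l) with hs
  have hs0 : 0 ≤ s := Real.sqrt_nonneg _
  have hs2 : s ^ 2 = T * l := Real.sq_sqrt (mul_nonneg hTpos.le hlog.le)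
  -- The square root of the sample bound multiplied by `T`; this is the source of `ε⁻⁴` and `lam⁴`.
  have h1 : lam ^ 2 * D * s ≤ T * ε ^ 2 := by
    refine le_of_sq_le_sq ?_ (by positivity)
    have e : (lam ^ 2 * D * s) ^ 2 = T * (lam ^ 4 * l * D ^ 2) := by
      rw [mul_pow, hs2]; ring
    rw [e]
    have := mul_le_mul_of_nonneg_left hTε hTpos.le
    linarith
  have h2 : 15 * (lam * gradBound pmax lam) * s ≤ κ * (T * ε ^ 2) := by
    have h3 := gradBound_le_rate hq h0 hlam
    calc 15 * (lam * gradBound pmax lam) * s = (15 * gradBound pmax lam) * (lam * s) := by ring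
      _ ≤ (κ * lam * D) * (lam * s) := mul_le_mul_of_nonneg_right h3 (by positivity)
      _ = κ * (lam ^ 2 * D * s) := by ring
      _ ≤ _ := mul_le_mul_of_nonneg_left h1 hκ0.le
  have h3 := le_of_mul_le_mul_left (le_of_mul_le_mul_left (hXi.trans h2) hκ0) hTpos
  exact abs_le_of_sq_le_sq h3 hε.le

end Recovery
end MissingIsing

theorem mainTheorem3 :
    -- restricted strong convexity of the modified objective in the non-field coordinates
    (∀ (n : ℕ) (A : Matrix (Fin n) (Fin n) ℝ) (θ : Fin n → ℝ) (r : Fin n) (lam : ℝ),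
      A.IsSymm → (∀ i, A i i = 0) → MissingIsing.width A θ ≤ lam →
      ∀ v : Fin n → ℝ, ∑ i, |v i| ≤ lam →
        MissingIsing.iso A θ r v - MissingIsing.iso A θ r (MissingIsing.truth A θ r) ≥
          fderiv ℝ (MissingIsing.iso A θ r) (MissingIsing.truth A θ r)
              (v - MissingIsing.truth A θ r)
            + Real.exp (-3 * lam) / (2 * (1 + lam))
              * ‖fun i : {i : Fin n // i ≠ r} => v i - A r i‖ ^ 2) ∧
    -- the gradient estimator is unbiased, and bounded on the simplex
    (∀ (n : ℕ) (A : Matrix (Fin n) (Fin n) ℝ) (θ : Fin n → ℝ) (r : Fin n)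
      (p : Fin n → unitInterval) (pmax lam : ℝ),
      A.IsSymm → (∀ i, A i i = 0) → pmax < 1 → (∀ i, (p i : ℝ) ≤ pmax) →
      (∀ w : MissingIsing.Coord n → ℝ,
        HasFDerivAt (fun u => MissingIsing.iso A θ r (MissingIsing.toBall u))
          (∑ k, (∫ x, MissingIsing.gradMiss p r w x k ∂(MissingIsing.missLaw A θ p)) •
            ContinuousLinearMap.proj (R := ℝ) (φ := fun _ : MissingIsing.Coord n => ℝ) k) w) ∧
      (∀ w ∈ MissingIsing.simplex n lam, ∀ x : Fin n → ℤ,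
        (∀ i, x i = -1 ∨ x i = 0 ∨ x i = 1) →
        ‖MissingIsing.gradMiss p r w x‖ ≤ 1 / (1 - pmax) ^ 2 * Real.exp (lam / (1 - pmax)))) ∧
    -- the algorithm recovers all the edge weights at the vertex `r`
    (∀ pmax < (1 : ℝ), ∀ lam₀ > (0 : ℝ), ∃ C > (0 : ℝ),
      ∀ (n : ℕ) (r : Fin n) (p : Fin n → unitInterval) (lam : ℝ) (T : ℕ),
        (∀ i, (p i : ℝ) ≤ pmax) → lam₀ ≤ lam →
        ∃ η > (0 : ℝ),
          ∀ (A : Matrix (Fin n) (Fin n) ℝ) (θ : Fin n → ℝ) (ε δ : ℝ),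
            A.IsSymm → (∀ i, A i i = 0) → MissingIsing.width A θ ≤ lam →
            0 < ε → 0 < δ → δ < 1 →
            (T : ℝ) ≥ lam ^ 4 * Real.log (n / δ) * Real.exp (C * lam) * ε⁻¹ ^ 4 →
            (MeasureTheory.Measure.pi fun _ : Fin T => MissingIsing.missLaw A θ p).real
              {X | ∀ i, i ≠ r →
                |MissingIsing.toBall (MissingIsing.smgOutput p r η lam X) i - A r i| ≤ ε}
              ≥ 1 - δ) := by
  refine ⟨fun n A θ r lam hA hd hw v hv => MissingIsing.iso_ge_of_sum_abs_le hA hd hw r hv,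
    fun n A θ r p pmax lam _ _ hq hp =>
      ⟨MissingIsing.hasFDerivAt_iso_toBall (fun i => (hp i).trans_lt hq) r,
        fun w hw x hx => MissingIsing.norm_gradMiss_le r hq hp hw hx⟩,
    fun pmax hq lam₀ h0 => ⟨MissingIsing.rateConst pmax lam₀, MissingIsing.rateConst_pos hq h0, ?_⟩⟩
  intro n r p lam T hp hlam
  refine ⟨MissingIsing.stepSize n T pmax lam, MissingIsing.stepSize_pos (Fin.pos r) T hq, ?_⟩
  intro A θ ε δ hA hd hw hε hδ hδ1 hT
  exact MissingIsing.recovery hq h0 r hp hlam hA hd hw hε hδ hδ1 hT
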